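/- **Setting.** Define $a_0=5/2$ and $2(k+1)(4k^2+5/4)a_{k+1}+(2k-1)a_k=0$ for $k\ge 0$ (so $a_1=1$), let $X_0(x)=\sum_{k\ge 0}a_kx^{2k}=5/2+x^2-\tfrac1{21}x^4+\cdots$, and put $h(x,y)=2X_0-xX_0'+y^2X_0'/x+\sqrt5$, $B_2(x)=-\tfrac12X_0'/x-\sqrt5$, $C_2(x)=X_0''-X_0'/x$. On $D=\{(x,y)\in\mathbb R^2: x>0\}$ let $$a_1=\tfrac{2y}{xh}\bigl(X_0+\tfrac{\sqrt5}2\bigr),\quad b_1=\tfrac{-1}{xh}\bigl(X_0+\tfrac{\sqrt5}2+\sqrt5(x^2-y^2)\bigr),\quad c_1=\tfrac{-2}{xh}\bigl(X_0+\tfrac{\sqrt5}2\bigr),$$ $$a_2=\tfrac{-1}{h}\bigl(2X_0+\sqrt5-(x^2+y^2)\tfrac{X_0'}x\bigr),\quad b_2=\tfrac{-2y}{h}\bigl(\tfrac{X_0'}{2x}+\sqrt5\bigr),\quad c_2=\tfrac{2y}{h}\bigl(X_0''-\tfrac{X_0'}x\bigr).$$ A *curvature surface on $D$* determined by a frame field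 is a map $f^0:D\to\mathbb R^4$ together with an orthonormal frame field $F^0=[\phi,X_\alpha,X_\beta,\xi]$ of $\mathbb R^4$ on $D$ such that $$\phi_x=-a_1X_\alpha,\quad (X_\alpha)_x=a_1\phi-c_1X_\beta-b_1\xi,\quad (X_\beta)_x=c_1X_\alpha,\quad \xi_x=b_1X_\alpha,$$ $$\phi_y=-a_2X_\beta,\quad (X_\alpha)_y=c_2X_\beta,\quad (X_\beta)_y=a_2\phi-c_2X_\alpha-b_2\xi,\quad \xi_y=b_2X_\beta,$$ $$df^0=\frac{x^2-y^2}{xh}X_\alpha\,dx+\frac{2y}{h}X_\beta\,dy .$$ ($F^0$ and $f^0$ are differentiable on $D$, and these are their total derivatives.) **Statement.** Let $(f^0,F^0)$ be a curvature surface on $D$. Then the following objects exist and are unique. * A constant orthonormal frame $[\boldsymbol b^\infty,\boldsymbol c^\infty,\tilde{\boldsymbol b}^\infty,\tilde{\boldsymbol c}^\infty]$ of $\mathbb R^4$ such that $X_\alpha(e^{-t},y)-\bigl(\cos\tfrac{\sqrt5t}2\,\boldsymbol b^\infty-\sin\tfrac{\sqrt5t}2\,\boldsymbol c^\infty\bigr)\to0$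 as $t\to\infty$, uniformly in $y\in\mathbb R$, and, for all $(x,y)\in D$, $\boldsymbol u:=(1+y^2)^{-1/2}(yX_\beta-\phi)(x,y)=-\sin(y-\arctan y)\,\tilde{\boldsymbol b}^\infty+\cos(y-\arctan y)\,\tilde{\boldsymbol c}^\infty$. * A curve $A:\mathbb R\to\mathbb R^4$ with $$f^0(x,y)=\tfrac{1}{2\sqrt5}\sqrt{\tfrac{5+4y^2}{1+y^2}}\;\boldsymbol f(x,y)+A(y),\qquad \boldsymbol f=\frac{X_\beta-2(1+y^2)\xi+y\phi}{\sqrt{(1+y^2)(5+4y^2)}},$$ such that, for each $y$, $\boldsymbol u=\boldsymbol u(y)$ is a unit vector independent of $x$ and the $x$-curve $f^0(\cdot,y)$ lies on the 2-sphere $\mathbb S^2_y$ with centre $A(y)$ and radius $\tfrac1{2\sqrt5}\sqrt{(5+4y^2)/(1+y^2)}$ in the affine hyperplane through $A(y)$ perpendicular to $\boldsymbol u(y)$. * A curve $\tilde A:(0,\infty)\to\mathbb R^4$ with $$f^0(x,y)=(B_2^2+C_2^2)^{-1/2}(x)\,\tilde{\boldsymbol f}(x,y)+\tilde A(x),\qquad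 \tilde{\boldsymbol f}=\frac{B_2\xi+C_2X_\alpha}{\sqrt{B_2^2+C_2^2}},$$ such that, for each $x>0$, $\tilde{\boldsymbol u}:=(B_2^2+C_2^2)^{-1/2}(-B_2X_\alpha+C_2\xi)=\tilde{\boldsymbol u}(x)$ is a unit vector independent of $y$ and the $y$-curve $f^0(x,\cdot)$ lies on the 2-sphere $\mathbb S^2_x$ with centre $\tilde A(x)$ and radius $(B_2^2+C_2^2)^{-1/2}(x)$ in the affine hyperplane through $\tilde A(x)$ perpendicular to $\tilde{\boldsymbol u}(x)$. Moreover: 1. the centre curve $A(y)$, $y\in\mathbb R$, lies in an affine plane parallel to $\operatorname{span}(\tilde{\boldsymbol b}^\infty,\tilde{\boldsymbol c}^\infty)$; 2. the centre curve $\tilde A(x)$, $x>0$, lies in an affine plane parallel to $\operatorname{span}(\boldsymbol b^\infty,\boldsymbol c^\infty)$. -/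

import Mathlib

open Filter Topology
open scoped BigOperators

noncomputable section

namespace CurvSurf

/-- Euclidean four-space. -/
abbrev E4 : Type := EuclideanSpace ℝ (Fin 4)

/-- The half plane `x > 0`. -/
def D : Set (ℝ × ℝ) := {p | 0 < p.1}

/-- Coefficients of the even power series `X₀`. The recursion
`2 (k+1) (4k² + 5/4) a (k+1) + (2k-1) a k = 0`, started at `a 0 = 5/2`, gives `a 1 = 1`. -/
def a : ℕ → ℝ
  | 0 => 5 / 2
  | k + 1 => -((2 * (k : ℝ) - 1) / (2 * ((k : ℝ) + 1) * (4 * (k : ℝ) ^ 2 + 5 / 4))) * a k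

theorem a_one : a 1 = 1 := by
  norm_num [a]

/-- The hypergeometric function `X₀(x) = 5/2 + x² - x⁴/21 + ⋯` (an everywhere convergent series). -/
def X0 (x : ℝ) : ℝ := ∑' k : ℕ, a k * x ^ (2 * k)

/-- `X₀'`. -/
def X0d (x : ℝ) : ℝ := deriv X0 x

/-- `X₀''`. -/
def X0dd (x : ℝ) : ℝ := deriv X0d x

def h (x y : ℝ) : ℝ := 2 * X0 x - x * X0d x + y ^ 2 * (X0d x / x) + √5

def a1 (x y : ℝ) : ℝ := 2 * y / (x * h x y) * (X0 x + √5 / 2)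

def b1 (x y : ℝ) : ℝ := -1 / (x * h x y) * (X0 x + √5 / 2 + √5 * (x ^ 2 - y ^ 2))

def c1 (x y : ℝ) : ℝ := -2 / (x * h x y) * (X0 x + √5 / 2)

def a2 (x y : ℝ) : ℝ := -1 / h x y * (2 * X0 x + √5 - (x ^ 2 + y ^ 2) * (X0d x / x))

def b2 (x y : ℝ) : ℝ := -2 * y / h x y * (X0d x / (2 * x) + √5)

def c2 (x y : ℝ) : ℝ := 2 * y / h x y * (X0dd x - X0d x / x)

/-- The `dx`-part of the connection matrix `Ω = Ω₁ dx + Ω₂ dy`. -/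
def Omega1 (x y : ℝ) : Matrix (Fin 4) (Fin 4) ℝ :=
  !![0, a1 x y, 0, 0;
     -a1 x y, 0, c1 x y, b1 x y;
     0, -c1 x y, 0, 0;
     0, -b1 x y, 0, 0]

/-- The `dy`-part of the connection matrix `Ω = Ω₁ dx + Ω₂ dy`. -/
def Omega2 (x y : ℝ) : Matrix (Fin 4) (Fin 4) ℝ :=
  !![0, 0, a2 x y, 0;
     0, 0, -c2 x y, 0;
     -a2 x y, c2 x y, 0, b2 x y;
     0, 0, -b2 x y, 0]

/-- `f` is a curvature surface on `D` determined by the orthonormal frame field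
`F = [φ, X_α, X_β, ξ]` (the vectors `F p 0, F p 1, F p 2, F p 3`): `dF = F Ω` and
`df = ((x² - y²) / (x h)) X_α dx + (2 y / h) X_β dy` on `D`. -/
structure IsCurvatureSurface (f : ℝ × ℝ → E4) (F : ℝ × ℝ → Fin 4 → E4) : Prop where
  orthonormal : ∀ p ∈ D, Orthonormal ℝ (F p)
  structure_eq : ∀ p ∈ D, ∀ j : Fin 4,
    HasFDerivAt (fun q => F q j)
      (∑ i : Fin 4, (Omega1 p.1 p.2 i j • ContinuousLinearMap.fst ℝ ℝ ℝ +
        Omega2 p.1 p.2 i j • ContinuousLinearMap.snd ℝ ℝ ℝ).smulRight (F p i)) p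
  surface_eq : ∀ p ∈ D,
    HasFDerivAt f
      ((((p.1 ^ 2 - p.2 ^ 2) / (p.1 * h p.1 p.2)) •
          ContinuousLinearMap.fst ℝ ℝ ℝ).smulRight (F p 1) +
        ((2 * p.2 / h p.1 p.2) • ContinuousLinearMap.snd ℝ ℝ ℝ).smulRight (F p 2)) p

def B2 (x : ℝ) : ℝ := -(1 / 2) * (X0d x / x) - √5

def C2 (x : ℝ) : ℝ := X0dd x - X0d x / x

/-- The unit vector `u = (1 + y²)^{-1/2} (y X_β - φ)`. -/
def uVec (F : ℝ × ℝ → Fin 4 → E4) (p : ℝ × ℝ) : E4 :=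
  (√(1 + p.2 ^ 2))⁻¹ • (p.2 • F p 2 - F p 0)

/-- The unit vector `ũ = (B₂² + C₂²)^{-1/2} (-B₂ X_α + C₂ ξ)`. -/
def utVec (F : ℝ × ℝ → Fin 4 → E4) (p : ℝ × ℝ) : E4 :=
  (√(B2 p.1 ^ 2 + C2 p.1 ^ 2))⁻¹ • (-B2 p.1 • F p 1 + C2 p.1 • F p 3)

/-- The unit vector `𝐟 = ((1 + y²)(5 + 4y²))^{-1/2} (X_β - 2 (1 + y²) ξ + y φ)`. -/
def fVec (F : ℝ × ℝ → Fin 4 → E4) (p : ℝ × ℝ) : E4 :=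
  (√((1 + p.2 ^ 2) * (5 + 4 * p.2 ^ 2)))⁻¹ •
    (F p 2 - (2 * (1 + p.2 ^ 2)) • F p 3 + p.2 • F p 0)

/-- The unit vector `𝐟̃ = (B₂² + C₂²)^{-1/2} (B₂ ξ + C₂ X_α)`. -/
def ftVec (F : ℝ × ℝ → Fin 4 → E4) (p : ℝ × ℝ) : E4 :=
  (√(B2 p.1 ^ 2 + C2 p.1 ^ 2))⁻¹ • (B2 p.1 • F p 3 + C2 p.1 • F p 1)

/-- The radius of the sphere `S²_y`. -/
def radX (y : ℝ) : ℝ := (2 * √5)⁻¹ * √((5 + 4 * y ^ 2) / (1 + y ^ 2))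

/-- The radius of the sphere `S²_x`. -/
def radY (x : ℝ) : ℝ := (√(B2 x ^ 2 + C2 x ^ 2))⁻¹

/-- The two-sphere with centre `c` and radius `r` in the affine hyperplane through `c`
perpendicular to `n`. -/
def twoSphere (c n : E4) (r : ℝ) : Set E4 := {q | dist q c = r ∧ inner ℝ (q - c) n = 0}

/-- `A` is the centre curve of the spheres `S²_y`: `f(x,y) = radX(y) 𝐟(x,y) + A(y)`, and every
`x`-curve lies on the two-sphere with centre `A(y)` and radius `radX(y)` perpendicular to `u(y)`. -/
structure IsCentreCurveX (f : ℝ × ℝ → E4) (F : ℝ × ℝ → Fin 4 → E4) (A : ℝ → E4) : Prop where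
  expansion : ∀ p ∈ D, f p = radX p.2 • fVec F p + A p.2
  sphere : ∀ y : ℝ, ∃ n : E4, ‖n‖ = 1 ∧ ∀ x : ℝ, 0 < x →
    uVec F (x, y) = n ∧ f (x, y) ∈ twoSphere (A y) n (radX y)

/-- `At` is the centre curve of the spheres `S²_x`, `x > 0`:
`f(x,y) = radY(x) 𝐟̃(x,y) + Ã(x)`, and every `y`-curve lies on the two-sphere with centre `Ã(x)`
and radius `radY(x)` perpendicular to `ũ(x)`. -/
structure IsCentreCurveY (f : ℝ × ℝ → E4) (F : ℝ × ℝ → Fin 4 → E4)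
    (At : Set.Ioi (0 : ℝ) → E4) : Prop where
  expansion : ∀ (x : Set.Ioi (0 : ℝ)) (y : ℝ),
    f (x, y) = radY x • ftVec F (x, y) + At x
  sphere : ∀ x : Set.Ioi (0 : ℝ), ∃ n : E4, ‖n‖ = 1 ∧ ∀ y : ℝ,
    utVec F (x, y) = n ∧ f (x, y) ∈ twoSphere (At x) n (radY x)

/-- `e = [b^∞, c^∞, b̃^∞, c̃^∞]` is the constant orthonormal frame attached to `F`: as `t → ∞`,
`X_α(e^{-t}, y)` converges to `cos(√5 t/2) b^∞ - sin(√5 t/2) c^∞` uniformly in `y ∈ ℝ`, and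
`u(y) = -sin(y - arctan y) b̃^∞ + cos(y - arctan y) c̃^∞`. -/
structure IsAsymptoticFrame (F : ℝ × ℝ → Fin 4 → E4) (e : Fin 4 → E4) : Prop where
  orthonormal : Orthonormal ℝ e
  limit : TendstoUniformly
    (fun t y : ℝ => F (Real.exp (-t), y) 1 -
      (Real.cos (√5 * t / 2) • e 0 - Real.sin (√5 * t / 2) • e 1))
    (fun _ => (0 : E4)) atTop
  rotation : ∀ p ∈ D, uVec F p =
    -Real.sin (p.2 - Real.arctan p.2) • e 2 + Real.cos (p.2 - Real.arctan p.2) • e 3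

end CurvSurf

end

noncomputable section

namespace CurvSurf

/-! ### Everywhere convergent real power series -/

/-- The coefficient sequence `b` has infinite radius of convergence. -/
def EntireCoeff (b : ℕ → ℝ) : Prop := ∀ r : ℝ, 0 ≤ r → Summable fun k => |b k| * r ^ k

/-- The sum of the power series with coefficients `b`. -/
def powSum (b : ℕ → ℝ) (z : ℝ) : ℝ := ∑' k : ℕ, b k * z ^ k

/-- The coefficients of the derived power series. -/
def derivCoeff (b : ℕ → ℝ) (k : ℕ) : ℝ := (k + 1) * b (k + 1)

theorem EntireCoeff.summable {b : ℕ → ℝ} (hb : EntireCoeff b) (z : ℝ) :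
    Summable fun k => b k * z ^ k := by
  refine Summable.of_norm ?_
  simpa [abs_mul, abs_pow] using hb |z| (abs_nonneg z)

theorem EntireCoeff.derivCoeff {b : ℕ → ℝ} (hb : EntireCoeff b) :
    EntireCoeff (derivCoeff b) := by
  intro r hr
  have h1 := (summable_nat_add_iff 1).mpr (hb (2 * (r + 1)) (by positivity))
  refine Summable.of_nonneg_of_le (fun k => by positivity) (fun k => ?_) h1
  have h2 : ((k : ℝ) + 1) ≤ 2 ^ (k + 1) := by
    exact_mod_cast (Nat.lt_two_pow_self (n := k + 1)).le
  have h3 : r ^ k ≤ (r + 1) ^ (k + 1) :=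
    (pow_le_pow_left₀ hr (by linarith) k).trans
      (pow_le_pow_right₀ (by linarith) (Nat.le_succ k))
  rw [CurvSurf.derivCoeff, abs_mul, abs_of_nonneg (by positivity : (0 : ℝ) ≤ k + 1), mul_pow]
  calc ((k : ℝ) + 1) * |b (k + 1)| * r ^ k = |b (k + 1)| * (((k : ℝ) + 1) * r ^ k) := by ring
    _ ≤ |b (k + 1)| * (2 ^ (k + 1) * (r + 1) ^ (k + 1)) := by gcongr

theorem EntireCoeff.hasDerivAt {b : ℕ → ℝ} (hb : EntireCoeff b) (z : ℝ) :
    HasDerivAt (powSum b) (powSum (CurvSurf.derivCoeff b) z) z := by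
  have hu : Summable fun n : ℕ => |b n| * (n * (|z| + 1) ^ (n - 1)) := by
    refine (summable_nat_add_iff 1).mp ?_
    refine (hb.derivCoeff (|z| + 1) (by positivity)).congr fun k => ?_
    rw [CurvSurf.derivCoeff, abs_mul, abs_of_nonneg (by positivity : (0 : ℝ) ≤ k + 1)]
    push_cast
    ring
  have h1 := hasDerivAt_tsum_of_isPreconnected (g := fun n y => b n * y ^ n)
    (g' := fun n y => b n * (n * y ^ (n - 1))) (t := Metric.ball 0 (|z| + 1)) (y₀ := 0) (y := z)
    hu Metric.isOpen_ball (convex_ball _ _).isPreconnected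
    (fun n y _ => (hasDerivAt_pow n y).const_mul (b n))
    (fun n y hy => by
      have hy' : |y| ≤ |z| + 1 := by simpa using (Metric.mem_ball.mp hy).le
      rw [norm_mul, norm_mul, norm_pow, Real.norm_eq_abs, Real.norm_eq_abs, Real.norm_eq_abs,
        Nat.abs_cast]
      gcongr)
    (by simp; positivity) (hb.summable 0) (by simp)
  refine h1.congr_deriv ?_
  have h2 : Summable fun n : ℕ => b n * (n * z ^ (n - 1)) := by
    refine (summable_nat_add_iff 1).mp ((hb.derivCoeff.summable z).congr fun k => ?_)
    rw [CurvSurf.derivCoeff]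
    push_cast
    ring
  rw [h2.tsum_eq_zero_add, powSum]
  simp only [Nat.cast_zero, zero_mul, mul_zero, zero_add]
  refine tsum_congr fun k => ?_
  rw [CurvSurf.derivCoeff]
  push_cast
  ring

theorem EntireCoeff.hasSum {b : ℕ → ℝ} (hb : EntireCoeff b) (z : ℝ) :
    HasSum (fun k => b k * z ^ k) (powSum b z) := (hb.summable z).hasSum

theorem EntireCoeff.hasSum_mul_deriv {b : ℕ → ℝ} (hb : EntireCoeff b) (z : ℝ) :
    HasSum (fun k : ℕ => k * b k * z ^ k) (z * powSum (CurvSurf.derivCoeff b) z) := by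
  rw [← hasSum_nat_add_iff' 1]
  simp only [Finset.sum_range_one, Nat.cast_zero, zero_mul, sub_zero]
  refine ((hb.derivCoeff.hasSum z).mul_left z).congr_fun ?_
  intro k
  rw [CurvSurf.derivCoeff]
  push_cast
  ring

theorem EntireCoeff.hasSum_sq_mul_deriv_deriv {b : ℕ → ℝ} (hb : EntireCoeff b) (z : ℝ) :
    HasSum (fun k : ℕ => k * (k - 1) * b k * z ^ k)
      (z ^ 2 * powSum (CurvSurf.derivCoeff (CurvSurf.derivCoeff b)) z) := by
  rw [← hasSum_nat_add_iff' 1]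
  simp only [Finset.sum_range_one, Nat.cast_zero, zero_mul, sub_zero]
  have := (hb.derivCoeff.hasSum_mul_deriv z).mul_left z
  rw [← mul_assoc, ← sq] at this
  refine this.congr_fun ?_
  intro k
  rw [CurvSurf.derivCoeff]
  push_cast
  ring

/-! ### The function `X₀` and its first integral -/

theorem a_succ (k : ℕ) :
    a (k + 1) = -((2 * (k : ℝ) - 1) / (2 * ((k : ℝ) + 1) * (4 * (k : ℝ) ^ 2 + 5 / 4))) * a k :=
  rfl

theorem abs_a_le (k : ℕ) : |a k| ≤ 5 / 2 / (k.factorial : ℝ) := by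
  induction k with
  | zero => norm_num [a]
  | succ k ih =>
    have h1 : |-((2 * (k : ℝ) - 1) / (2 * ((k : ℝ) + 1) * (4 * (k : ℝ) ^ 2 + 5 / 4)))|
        ≤ 1 / ((k : ℝ) + 1) := by
      rw [abs_neg, abs_div, abs_of_pos (by positivity :
        (0 : ℝ) < 2 * ((k : ℝ) + 1) * (4 * (k : ℝ) ^ 2 + 5 / 4)),
        div_le_div_iff₀ (by positivity) (by positivity)]
      have h2 : |2 * (k : ℝ) - 1| ≤ 2 * (4 * (k : ℝ) ^ 2 + 5 / 4) := by
        rw [abs_le]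
        constructor <;> nlinarith [sq_nonneg (4 * (k : ℝ) - 1), sq_nonneg (4 * (k : ℝ) + 1)]
      have h3 : (0 : ℝ) < k + 1 := by positivity
      nlinarith
    rw [a_succ, abs_mul, Nat.factorial_succ]
    push_cast
    calc _ ≤ 1 / ((k : ℝ) + 1) * (5 / 2 / (k.factorial : ℝ)) := by gcongr
      _ = _ := by field_simp

theorem entireCoeff_a : EntireCoeff a := by
  intro r hr
  refine Summable.of_nonneg_of_le (fun k => by positivity) (fun k => ?_)
    ((Real.summable_pow_div_factorial r).mul_left (5 / 2))
  calc |a k| * r ^ k ≤ 5 / 2 / (k.factorial : ℝ) * r ^ k := by gcongr; exact abs_a_le k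
    _ = 5 / 2 * (r ^ k / k.factorial) := by ring

/-- `X₀(x) = P₀(x²)`. -/
def P0 : ℝ → ℝ := powSum a
/-- `P₁ = P₀'`. -/
def P1 : ℝ → ℝ := powSum (derivCoeff a)
/-- `P₂ = P₁'`. -/
def P2 : ℝ → ℝ := powSum (derivCoeff (derivCoeff a))
/-- `P₃ = P₂'`. -/
def P3 : ℝ → ℝ := powSum (derivCoeff (derivCoeff (derivCoeff a)))

theorem hasDerivAt_P0 (z : ℝ) : HasDerivAt P0 (P1 z) z := entireCoeff_a.hasDerivAt z
theorem hasDerivAt_P1 (z : ℝ) : HasDerivAt P1 (P2 z) z := entireCoeff_a.derivCoeff.hasDerivAt z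
theorem hasDerivAt_P2 (z : ℝ) : HasDerivAt P2 (P3 z) z :=
  entireCoeff_a.derivCoeff.derivCoeff.hasDerivAt z

theorem powSum_zero (b : ℕ → ℝ) : powSum b 0 = b 0 := by
  rw [powSum, tsum_eq_single 0 fun k hk => by simp [hk]]
  simp

theorem P0_zero : P0 0 = 5 / 2 := by rw [P0, powSum_zero, a]

theorem P1_zero : P1 0 = 1 := by rw [P1, powSum_zero, derivCoeff, a_one]; norm_num

/-- The differential equation of `X₀` in the variable `z = x²`. -/
theorem P_ode (z : ℝ) :
    8 * z * P2 z + 8 * z ^ 2 * P3 z = -(5 / 2) * P1 z + P0 z - 2 * z * P1 z := by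
  have hA := entireCoeff_a
  have h1 := (hA.derivCoeff.hasSum_mul_deriv z).mul_left 8
  have h2 := (hA.derivCoeff.hasSum_sq_mul_deriv_deriv z).mul_left 8
  have h3 := (hA.derivCoeff.hasSum z).mul_left (5 / 2)
  have h4 := hA.hasSum z
  have h5 := (hA.hasSum_mul_deriv z).mul_left 2
  have h6 := (((h1.add h2).add h3).sub h4).add h5
  have h7 : HasSum (fun _ : ℕ => (0 : ℝ)) 0 := hasSum_zero
  have h8 := (h6.congr_fun (g := fun _ => 0) ?_).unique h7
  · simp only [P0, P1, P2, P3]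
    linear_combination h8
  · intro k
    simp only [derivCoeff, a_succ]
    field_simp
    ring

/-- The first integral in the variable `z = x²`. -/
theorem P_first_integral (z : ℝ) :
    16 * z ^ 2 * P2 z ^ 2 + 5 * P1 z ^ 2 + 4 * z * P1 z ^ 2 - 4 * P0 z * P1 z + 5 = 0 := by
  have hd : ∀ z : ℝ, HasDerivAt (fun z => 16 * z ^ 2 * P2 z ^ 2 + 5 * P1 z ^ 2
      + 4 * z * P1 z ^ 2 - 4 * P0 z * P1 z + 5) 0 z := by
    intro z
    have := ((((((hasDerivAt_pow 2 z).const_mul 16).mul ((hasDerivAt_P2 z).pow 2)).add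
      (((hasDerivAt_P1 z).pow 2).const_mul 5)).add
      (((hasDerivAt_id z).const_mul 4).mul ((hasDerivAt_P1 z).pow 2))).sub
      (((hasDerivAt_P0 z).const_mul 4).mul (hasDerivAt_P1 z))).add_const (5 : ℝ)
    refine this.congr_deriv ?_
    simp only [id, Pi.pow_apply]
    push_cast
    linear_combination 4 * P2 z * P_ode z
  have := is_const_of_deriv_eq_zero (fun z => (hd z).differentiableAt) (fun z => (hd z).deriv) z 0
  rw [this, P0_zero, P1_zero]
  norm_num

theorem P1_pos {z : ℝ} (hz : 0 ≤ z) : 0 < P1 z := by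
  have hne : ∀ t, 0 ≤ t → P1 t ≠ 0 := by
    intro t ht h0
    have h1 := P_first_integral t
    rw [h0] at h1
    nlinarith [mul_nonneg (sq_nonneg t) (sq_nonneg (P2 t))]
  by_contra! hneg
  have hc : ContinuousOn P1 (Set.Icc 0 z) := fun t _ =>
    (hasDerivAt_P1 t).continuousAt.continuousWithinAt
  obtain ⟨t, ht, h0⟩ := intermediate_value_Icc' hz hc ⟨hneg, by rw [P1_zero]; norm_num⟩
  exact hne t ht.1 h0

/-- The even entire extension of `X₀'(x)/x`. -/
def G (x : ℝ) : ℝ := 2 * P1 (x ^ 2)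

/-- The even entire extension of `C₂`. -/
def C (x : ℝ) : ℝ := 4 * x ^ 2 * P2 (x ^ 2)

theorem X0_eq (x : ℝ) : X0 x = P0 (x ^ 2) := by
  simp only [X0, P0, powSum, pow_mul]

theorem hasDerivAt_X0 (x : ℝ) : HasDerivAt X0 (x * G x) x := by
  have h1 := (hasDerivAt_P0 (x ^ 2)).comp x (hasDerivAt_pow 2 x)
  rw [show X0 = P0 ∘ fun x => x ^ 2 from funext X0_eq]
  refine h1.congr_deriv ?_
  simp only [G]
  push_cast
  ring

theorem X0d_eq (x : ℝ) : X0d x = x * G x := (hasDerivAt_X0 x).deriv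

theorem hasDerivAt_G' (x : ℝ) : HasDerivAt G (4 * x * P2 (x ^ 2)) x := by
  have h1 := ((hasDerivAt_P1 (x ^ 2)).comp x (hasDerivAt_pow 2 x)).const_mul 2
  refine h1.congr_deriv ?_
  push_cast
  ring

theorem hasDerivAt_G {x : ℝ} (hx : 0 < x) : HasDerivAt G (C x / x) x := by
  refine (hasDerivAt_G' x).congr_deriv ?_
  rw [C]
  field_simp

theorem hasDerivAt_C' (x : ℝ) :
    HasDerivAt C (8 * x * P2 (x ^ 2) + 8 * x ^ 3 * P3 (x ^ 2)) x := by
  have h1 := ((hasDerivAt_pow 2 x).const_mul 4).mul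
    ((hasDerivAt_P2 (x ^ 2)).comp x (hasDerivAt_pow 2 x))
  refine h1.congr_deriv ?_
  simp only [Function.comp]
  push_cast
  ring

theorem hasDerivAt_C {x : ℝ} (hx : 0 < x) :
    HasDerivAt C ((X0 x - 5 / 4 * G x - x ^ 2 * G x) / x) x := by
  refine (hasDerivAt_C' x).congr_deriv ?_
  rw [eq_div_iff hx.ne', X0_eq, G]
  linear_combination P_ode (x ^ 2)

theorem X0dd_eq (x : ℝ) : X0dd x = G x + C x := by
  have h1 : HasDerivAt X0d (1 * G x + x * (4 * x * P2 (x ^ 2))) x := by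
    rw [show X0d = fun x => x * G x from funext X0d_eq]
    exact (hasDerivAt_id x).mul (hasDerivAt_G' x)
  rw [X0dd, h1.deriv, C]
  ring

theorem first_integral (x : ℝ) :
    C x ^ 2 + 5 / 4 * G x ^ 2 + x ^ 2 * G x ^ 2 - 2 * X0 x * G x + 5 = 0 := by
  rw [C, G, X0_eq]
  linear_combination P_first_integral (x ^ 2)

theorem G_pos (x : ℝ) : 0 < G x := mul_pos two_pos (P1_pos (sq_nonneg x))

theorem G_zero : G 0 = 2 := by norm_num [G, P1_zero]

theorem C_zero : C 0 = 0 := by simp [C]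

theorem X0_zero : X0 0 = 5 / 2 := by simp [X0_eq, P0_zero]

/-! ### The coefficient functions for `x > 0` -/

/-- The entire extension of `B₂`. -/
def B (x : ℝ) : ℝ := -(G x / 2) - √5

/-- `N = B₂² + C₂²`. -/
def N (x : ℝ) : ℝ := B x ^ 2 + C x ^ 2

/-- `q = 2 (1 + y²) X₀' / (x h) - 1`. -/
def q (x y : ℝ) : ℝ := 2 * (1 + y ^ 2) * G x / h x y - 1

/-- The speed of rotation of `ũ` with respect to `log x`. -/
def kappa (x : ℝ) : ℝ := -B x * (X0 x + √5 / 2) / N x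

theorem sqrt_five_sq : √5 ^ 2 = (5 : ℝ) := Real.sq_sqrt (by norm_num)

theorem sqrt_five_pos : (0 : ℝ) < √5 := Real.sqrt_pos.mpr (by norm_num)

theorem B_neg (x : ℝ) : B x < 0 := by
  have h1 := G_pos x
  have h2 := sqrt_five_pos
  rw [B]
  linarith

theorem N_pos (x : ℝ) : 0 < N x := by
  exact add_pos_of_pos_of_nonneg (sq_pos_of_ne_zero (B_neg x).ne) (sq_nonneg _)

theorem a1_eq (x y : ℝ) : a1 x y = 2 * y * (X0 x + √5 / 2) / (x * h x y) := by
  rw [a1]; ring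

theorem b1_eq (x y : ℝ) : b1 x y = -(X0 x + √5 / 2 + √5 * (x ^ 2 - y ^ 2)) / (x * h x y) := by
  rw [b1]; ring

theorem c1_eq (x y : ℝ) : c1 x y = -(2 * (X0 x + √5 / 2)) / (x * h x y) := by
  rw [c1]; ring

section
variable {x : ℝ} (hx : 0 < x) (y : ℝ)
include hx

theorem X0d_div_eq : X0d x / x = G x := by
  rw [X0d_eq]; field_simp

theorem B2_eq : B2 x = B x := by
  rw [B2, X0d_div_eq hx, B]; ring

theorem C2_eq : C2 x = C x := by
  rw [C2, X0d_div_eq hx, X0dd_eq]; ring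

theorem h_eq : h x y = 2 * X0 x - x ^ 2 * G x + y ^ 2 * G x + √5 := by
  rw [h, X0d_div_eq hx, X0d_eq]; ring

theorem h_mul_G : h x y * G x = N x + (1 + y ^ 2) * G x ^ 2 := by
  rw [h_eq hx, N, B]
  linear_combination -first_integral x - sqrt_five_sq

theorem h_pos : 0 < h x y := by
  have h1 := h_mul_G hx y
  have h2 := N_pos x
  have h3 := G_pos x
  refine pos_of_mul_pos_left (b := G x) ?_ h3.le
  rw [h1]
  positivity

theorem a2_eq : a2 x y = 2 * y ^ 2 * G x / h x y - 1 := by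
  have := (h_pos hx y).ne'
  rw [a2, X0d_div_eq hx]
  field_simp
  rw [h_eq hx]
  ring

theorem b2_eq : b2 x y = 2 * y * B x / h x y := by
  have h1 : X0d x / (2 * x) = G x / 2 := by rw [X0d_eq]; field_simp
  rw [b2, h1, B]; ring

theorem c2_eq : c2 x y = 2 * y * C x / h x y := by
  rw [c2, X0d_div_eq hx, X0dd_eq]; ring

theorem hasDerivAt_h_fst : HasDerivAt (fun x => h x y) ((y ^ 2 - x ^ 2) * C x / x) x := by
  have h1 : HasDerivAt (fun x => 2 * X0 x - x ^ 2 * G x + y ^ 2 * G x + √5)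
      ((y ^ 2 - x ^ 2) * C x / x) x := by
    have := (((hasDerivAt_X0 x).const_mul 2).sub ((hasDerivAt_pow 2 x).mul (hasDerivAt_G hx))).add
      ((hasDerivAt_G hx).const_mul (y ^ 2)) |>.add_const √5
    refine this.congr_deriv ?_
    push_cast
    field_simp
    ring
  refine h1.congr_of_eventuallyEq ?_
  filter_upwards [lt_mem_nhds hx] with t ht using h_eq ht y

theorem hasDerivAt_h_snd : HasDerivAt (fun y => h x y) (2 * y * G x) y := by
  have h1 : HasDerivAt (fun y => 2 * X0 x - x ^ 2 * G x + y ^ 2 * G x + √5)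
      (2 * y * G x) y := by
    have := (((hasDerivAt_pow 2 y).mul_const (G x)).const_add
      (2 * X0 x - x ^ 2 * G x)).add_const √5
    refine this.congr_deriv ?_
    push_cast
    ring
  exact h1.congr_of_eventuallyEq (Eventually.of_forall fun t => h_eq hx t)

theorem hasDerivAt_B : HasDerivAt B (-(C x / x / 2)) x :=
  ((hasDerivAt_G hx).div_const 2).neg.sub_const √5

theorem hasDerivAt_N :
    HasDerivAt N (C x * (2 * X0 x - 2 * G x - 2 * x ^ 2 * G x + √5) / x) x := by
  refine (((hasDerivAt_B hx).pow 2).add ((hasDerivAt_C hx).pow 2)).congr_deriv ?_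
  rw [B]
  push_cast
  field_simp
  ring

theorem hasDerivAt_q_fst : HasDerivAt (fun x => q x y)
    (2 * (1 + y ^ 2) * (C x / x) * (h x y - (y ^ 2 - x ^ 2) * G x) / h x y ^ 2) x := by
  have hh := (h_pos hx y).ne'
  refine ((((hasDerivAt_G hx).const_mul (2 * (1 + y ^ 2))).div (hasDerivAt_h_fst hx y)
    hh).sub_const 1).congr_deriv ?_
  field_simp

theorem hasDerivAt_q_snd : HasDerivAt (fun y => q x y)
    (4 * y * G x * (h x y - (1 + y ^ 2) * G x) / h x y ^ 2) y := by
  have hh := (h_pos hx y).ne'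
  refine (((((hasDerivAt_pow 2 y).const_add 1).const_mul 2).mul_const (G x)).div
    (hasDerivAt_h_snd hx y) hh).sub_const 1 |>.congr_deriv ?_
  push_cast
  field_simp
  ring

end

/-! ### Linear combinations of the frame and their partial derivatives -/

/-- The vector with coordinates `c₀, c₁, c₂, c₃` in the frame `F p`. -/
def comb (F : ℝ × ℝ → Fin 4 → E4) (p : ℝ × ℝ) (c₀ c₁ c₂ c₃ : ℝ) : E4 :=
  c₀ • F p 0 + c₁ • F p 1 + c₂ • F p 2 + c₃ • F p 3

theorem inner_comb {F : ℝ × ℝ → Fin 4 → E4} {p : ℝ × ℝ} (hF : Orthonormal ℝ (F p))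
    (c₀ c₁ c₂ c₃ d₀ d₁ d₂ d₃ : ℝ) :
    inner ℝ (comb F p c₀ c₁ c₂ c₃) (comb F p d₀ d₁ d₂ d₃) =
      c₀ * d₀ + c₁ * d₁ + c₂ * d₂ + c₃ * d₃ := by
  have key := hF.inner_sum ![c₀, c₁, c₂, c₃] ![d₀, d₁, d₂, d₃] Finset.univ
  simpa [Fin.sum_univ_four, comb] using key

section
variable {f : ℝ × ℝ → E4} {F : ℝ × ℝ → Fin 4 → E4} (hf : IsCurvatureSurface f F)
  {x : ℝ} (hx : 0 < x) (y : ℝ)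
include hf hx

theorem IsCurvatureSurface.hasDerivAt_frame_fst (j : Fin 4) :
    HasDerivAt (fun x => F (x, y) j) (∑ i : Fin 4, Omega1 x y i j • F (x, y) i) x := by
  have h1 := hf.structure_eq (x, y) hx j
  have h2 : HasDerivAt (fun x : ℝ => (x, y)) ((1 : ℝ), (0 : ℝ)) x :=
    (hasDerivAt_id x).prodMk (hasDerivAt_const x y)
  refine (h1.comp_hasDerivAt x h2).congr_deriv ?_
  simp

theorem IsCurvatureSurface.hasDerivAt_frame_snd (j : Fin 4) :
    HasDerivAt (fun y => F (x, y) j) (∑ i : Fin 4, Omega2 x y i j • F (x, y) i) y := by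
  have h1 := hf.structure_eq (x, y) hx j
  have h2 : HasDerivAt (fun y : ℝ => (x, y)) ((0 : ℝ), (1 : ℝ)) y :=
    (hasDerivAt_const y x).prodMk (hasDerivAt_id y)
  refine (h1.comp_hasDerivAt y h2).congr_deriv ?_
  simp

theorem IsCurvatureSurface.hasDerivAt_surface_fst :
    HasDerivAt (fun x => f (x, y)) (comb F (x, y) 0 ((x ^ 2 - y ^ 2) / (x * h x y)) 0 0) x := by
  have h1 := hf.surface_eq (x, y) hx
  have h2 : HasDerivAt (fun x : ℝ => (x, y)) ((1 : ℝ), (0 : ℝ)) x :=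
    (hasDerivAt_id x).prodMk (hasDerivAt_const x y)
  refine (h1.comp_hasDerivAt x h2).congr_deriv ?_
  simp [comb]

theorem IsCurvatureSurface.hasDerivAt_surface_snd :
    HasDerivAt (fun y => f (x, y)) (comb F (x, y) 0 0 (2 * y / h x y) 0) y := by
  have h1 := hf.surface_eq (x, y) hx
  have h2 : HasDerivAt (fun y : ℝ => (x, y)) ((0 : ℝ), (1 : ℝ)) y :=
    (hasDerivAt_const y x).prodMk (hasDerivAt_id y)
  refine (h1.comp_hasDerivAt y h2).congr_deriv ?_
  simp [comb]

theorem IsCurvatureSurface.hasDerivAt_comb_fst {v₀ v₁ v₂ v₃ : ℝ → ℝ} {d₀ d₁ d₂ d₃ : ℝ}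
    (h₀ : HasDerivAt v₀ d₀ x) (h₁ : HasDerivAt v₁ d₁ x) (h₂ : HasDerivAt v₂ d₂ x)
    (h₃ : HasDerivAt v₃ d₃ x) :
    HasDerivAt (fun x => comb F (x, y) (v₀ x) (v₁ x) (v₂ x) (v₃ x))
      (comb F (x, y) (d₀ + a1 x y * v₁ x)
        (d₁ - a1 x y * v₀ x + c1 x y * v₂ x + b1 x y * v₃ x)
        (d₂ - c1 x y * v₁ x) (d₃ - b1 x y * v₁ x)) x := by
  have hj := hf.hasDerivAt_frame_fst hx y
  refine ((((h₀.smul (hj 0)).add (h₁.smul (hj 1))).add (h₂.smul (hj 2))).add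
    (h₃.smul (hj 3))).congr_deriv ?_
  simp [comb, Fin.sum_univ_four, Omega1]
  module

theorem IsCurvatureSurface.hasDerivAt_comb_snd {v₀ v₁ v₂ v₃ : ℝ → ℝ} {d₀ d₁ d₂ d₃ : ℝ}
    (h₀ : HasDerivAt v₀ d₀ y) (h₁ : HasDerivAt v₁ d₁ y) (h₂ : HasDerivAt v₂ d₂ y)
    (h₃ : HasDerivAt v₃ d₃ y) :
    HasDerivAt (fun y => comb F (x, y) (v₀ y) (v₁ y) (v₂ y) (v₃ y))
      (comb F (x, y) (d₀ + a2 x y * v₂ y) (d₁ - c2 x y * v₂ y)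
        (d₂ - a2 x y * v₀ y + c2 x y * v₁ y + b2 x y * v₃ y)
        (d₃ - b2 x y * v₂ y)) y := by
  have hj := hf.hasDerivAt_frame_snd hx y
  refine ((((h₀.smul (hj 0)).add (h₁.smul (hj 1))).add (h₂.smul (hj 2))).add
    (h₃.smul (hj 3))).congr_deriv ?_
  simp [comb, Fin.sum_univ_four, Omega2]
  module

end

/-! ### The two rotating pairs -/

section
variable (F : ℝ × ℝ → Fin 4 → E4) (x y : ℝ)

/-- `√(1 + y²) u`. -/
def U : E4 := comb F (x, y) (-1) 0 y 0

/-- `√(1 + y²) w`, where `w` is the unit vector with `u' = -τ' w`, `τ = y - arctan y`. -/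
def W : E4 := comb F (x, y) (-(q x y * y)) (2 * (1 + y ^ 2) * C x / h x y) (-q x y)
  (2 * (1 + y ^ 2) * B x / h x y)

/-- `√N ũ`. -/
def Ut : E4 := comb F (x, y) 0 (-B x) 0 (C x)

/-- `√N w̃`, where `w̃` is the unit vector with `x ũ' = κ w̃`. -/
def Wt : E4 := comb F (x, y) (2 * N x * y / h x y) (q x y * C x) (2 * N x / h x y) (q x y * B x)

end

/-- The first vector of a rotating pair, rotated back and rescaled. -/
def rotA (ρ τ : ℝ) (U W : E4) : E4 := ρ • (Real.cos τ • W - Real.sin τ • U)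

/-- The second vector of a rotating pair, rotated back and rescaled. -/
def rotB (ρ τ : ℝ) (U W : E4) : E4 := ρ • (Real.sin τ • W + Real.cos τ • U)

theorem hasDerivAt_rotA {ρ τ : ℝ → ℝ} {U W : ℝ → E4} {t l m : ℝ}
    (hρ : HasDerivAt ρ (-l * ρ t) t) (hτ : HasDerivAt τ m t)
    (hU : HasDerivAt U (l • U t - m • W t) t) (hW : HasDerivAt W (l • W t + m • U t) t) :
    HasDerivAt (fun t => rotA (ρ t) (τ t) (U t) (W t)) 0 t := by
  refine (hρ.smul ((hτ.cos.smul hW).sub (hτ.sin.smul hU))).congr_deriv ?_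
  simp only [Pi.sub_apply, Pi.smul_apply']
  module

theorem hasDerivAt_rotB {ρ τ : ℝ → ℝ} {U W : ℝ → E4} {t l m : ℝ}
    (hρ : HasDerivAt ρ (-l * ρ t) t) (hτ : HasDerivAt τ m t)
    (hU : HasDerivAt U (l • U t - m • W t) t) (hW : HasDerivAt W (l • W t + m • U t) t) :
    HasDerivAt (fun t => rotB (ρ t) (τ t) (U t) (W t)) 0 t := by
  refine (hρ.smul ((hτ.sin.smul hW).add (hτ.cos.smul hU))).congr_deriv ?_
  simp only [Pi.add_apply, Pi.smul_apply']
  module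

theorem comb_congr {F : ℝ × ℝ → Fin 4 → E4} {p : ℝ × ℝ} {c₀ c₁ c₂ c₃ d₀ d₁ d₂ d₃ : ℝ}
    (h₀ : c₀ = d₀) (h₁ : c₁ = d₁) (h₂ : c₂ = d₂) (h₃ : c₃ = d₃) :
    comb F p c₀ c₁ c₂ c₃ = comb F p d₀ d₁ d₂ d₃ := by
  rw [h₀, h₁, h₂, h₃]

theorem comb_zero (F : ℝ × ℝ → Fin 4 → E4) (p : ℝ × ℝ) : comb F p 0 0 0 0 = 0 := by
  simp [comb]

theorem smul_comb (F : ℝ × ℝ → Fin 4 → E4) (p : ℝ × ℝ) (r c₀ c₁ c₂ c₃ : ℝ) :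
    r • comb F p c₀ c₁ c₂ c₃ = comb F p (r * c₀) (r * c₁) (r * c₂) (r * c₃) := by
  simp only [comb]; module

theorem comb_add (F : ℝ × ℝ → Fin 4 → E4) (p : ℝ × ℝ) (c₀ c₁ c₂ c₃ d₀ d₁ d₂ d₃ : ℝ) :
    comb F p c₀ c₁ c₂ c₃ + comb F p d₀ d₁ d₂ d₃ =
      comb F p (c₀ + d₀) (c₁ + d₁) (c₂ + d₂) (c₃ + d₃) := by
  simp only [comb]; module

theorem comb_sub (F : ℝ × ℝ → Fin 4 → E4) (p : ℝ × ℝ) (c₀ c₁ c₂ c₃ d₀ d₁ d₂ d₃ : ℝ) :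
    comb F p c₀ c₁ c₂ c₃ - comb F p d₀ d₁ d₂ d₃ =
      comb F p (c₀ - d₀) (c₁ - d₁) (c₂ - d₂) (c₃ - d₃) := by
  simp only [comb]; module

section
variable {f : ℝ × ℝ → E4} {F : ℝ × ℝ → Fin 4 → E4} (hf : IsCurvatureSurface f F)
  {x : ℝ} (hx : 0 < x) (y : ℝ)
include hf hx

theorem IsCurvatureSurface.hasDerivAt_U_fst : HasDerivAt (fun x => U F x y) 0 x := by
  refine (hf.hasDerivAt_comb_fst hx y (hasDerivAt_const x (-1)) (hasDerivAt_const x 0)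
    (hasDerivAt_const x y) (hasDerivAt_const x 0)).congr_deriv ?_
  rw [← comb_zero F (x, y), a1_eq, b1_eq, c1_eq]
  apply comb_congr <;> ring

theorem IsCurvatureSurface.hasDerivAt_Ut_snd : HasDerivAt (fun y => Ut F x y) 0 y := by
  refine (hf.hasDerivAt_comb_snd hx y (hasDerivAt_const y 0) (hasDerivAt_const y (-B x))
    (hasDerivAt_const y 0) (hasDerivAt_const y (C x))).congr_deriv ?_
  rw [← comb_zero F (x, y), a2_eq hx, b2_eq hx, c2_eq hx]
  apply comb_congr <;> ring

theorem IsCurvatureSurface.hasDerivAt_W_fst : HasDerivAt (fun x => W F x y) 0 x := by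
  have hh := (h_pos hx y).ne'
  have hq := (hasDerivAt_q_fst hx y)
  have hhx := (hasDerivAt_h_fst hx y)
  refine (hf.hasDerivAt_comb_fst hx y (hq.mul_const y).neg
    (((hasDerivAt_C hx).const_mul (2 * (1 + y ^ 2))).div hhx hh) hq.neg
    (((hasDerivAt_B hx).const_mul (2 * (1 + y ^ 2))).div hhx hh)).congr_deriv ?_
  simp only [Pi.neg_apply, Pi.div_apply]
  rw [← comb_zero F (x, y), a1_eq, b1_eq, c1_eq, q, B]
  have h1 := h_eq hx y
  have h2 := first_integral x
  have h3 := sqrt_five_sq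
  clear hq hhx hf
  apply comb_congr
  all_goals
    generalize h x y = H at *
    field_simp
    grind

theorem IsCurvatureSurface.hasDerivAt_U_snd : HasDerivAt (fun y => U F x y)
    ((y / (1 + y ^ 2)) • U F x y - (y ^ 2 / (1 + y ^ 2)) • W F x y) y := by
  have hh := (h_pos hx y).ne'
  refine (hf.hasDerivAt_comb_snd hx y (hasDerivAt_const y (-1)) (hasDerivAt_const y 0)
    (hasDerivAt_id y) (hasDerivAt_const y 0)).congr_deriv ?_
  simp only [id]
  rw [a2_eq hx, b2_eq hx, c2_eq hx, U, W, smul_comb, smul_comb, comb_sub, q, B]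
  apply comb_congr
  all_goals
    generalize h x y = H at *
    field_simp
    ring

theorem IsCurvatureSurface.hasDerivAt_W_snd : HasDerivAt (fun y => W F x y)
    ((y / (1 + y ^ 2)) • W F x y + (y ^ 2 / (1 + y ^ 2)) • U F x y) y := by
  have hh := (h_pos hx y).ne'
  have hq := (hasDerivAt_q_snd hx y)
  have hhy := (hasDerivAt_h_snd hx y)
  have h0 := ((hasDerivAt_pow 2 y).const_add 1).const_mul 2
  refine (hf.hasDerivAt_comb_snd hx y (hq.mul (hasDerivAt_id y)).neg
    ((h0.mul_const (C x)).div hhy hh) hq.neg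
    ((h0.mul_const (B x)).div hhy hh)).congr_deriv ?_
  simp only [Pi.neg_apply, Pi.mul_apply, Pi.div_apply, id]
  rw [a2_eq hx, b2_eq hx, c2_eq hx, U, W, smul_comb, smul_comb, comb_add, q]
  clear hq hhy hf
  have h1 := h_mul_G hx y
  rw [N] at h1
  apply comb_congr
  all_goals
    generalize h x y = H at *
    field_simp
    grind

theorem IsCurvatureSurface.hasDerivAt_Wt_snd : HasDerivAt (fun y => Wt F x y) 0 y := by
  have hh := (h_pos hx y).ne'
  have hq := (hasDerivAt_q_snd hx y)
  have hhy := (hasDerivAt_h_snd hx y)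
  refine (hf.hasDerivAt_comb_snd hx y (((hasDerivAt_id y).const_mul (2 * N x)).div hhy hh)
    (hq.mul_const (C x)) ((hasDerivAt_const y (2 * N x)).div hhy hh)
    (hq.mul_const (B x))).congr_deriv ?_
  simp only [Pi.div_apply, id]
  rw [← comb_zero F (x, y), a2_eq hx, b2_eq hx, c2_eq hx, q]
  clear hq hhy hf
  have h1 := h_mul_G hx y
  rw [N] at h1 ⊢
  apply comb_congr
  all_goals
    generalize h x y = H at *
    field_simp
    grind

theorem IsCurvatureSurface.hasDerivAt_Ut_fst : HasDerivAt (fun x => Ut F x y)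
    ((C x * (2 * X0 x - 2 * G x - 2 * x ^ 2 * G x + √5) / x / (2 * N x)) • Ut F x y -
      (-(kappa x / x)) • Wt F x y) x := by
  have hh := (h_pos hx y).ne'
  have hN := (N_pos x).ne'
  refine (hf.hasDerivAt_comb_fst hx y (hasDerivAt_const x 0) (hasDerivAt_B hx).neg
    (hasDerivAt_const x 0) (hasDerivAt_C hx)).congr_deriv ?_
  simp only [Pi.neg_apply]
  rw [a1_eq, b1_eq, c1_eq, Ut, Wt, smul_comb, smul_comb, comb_sub, kappa, q]
  have h1 := h_eq hx y
  have h2 := first_integral x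
  have h3 := sqrt_five_sq
  have h4 : N x = G x * (2 * X0 x - G x - x ^ 2 * G x + √5) := by
    rw [N, B]; linear_combination h2 + h3
  rw [h4] at hN ⊢
  rw [B]
  apply comb_congr
  all_goals
    generalize h x y = H at *
    field_simp
    grind

theorem IsCurvatureSurface.hasDerivAt_Wt_fst : HasDerivAt (fun x => Wt F x y)
    ((C x * (2 * X0 x - 2 * G x - 2 * x ^ 2 * G x + √5) / x / (2 * N x)) • Wt F x y +
      (-(kappa x / x)) • Ut F x y) x := by
  have hh := (h_pos hx y).ne'
  have hN := (N_pos x).ne'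
  have hq := (hasDerivAt_q_fst hx y)
  have hhx := (hasDerivAt_h_fst hx y)
  have hNx := ((hasDerivAt_N hx).const_mul 2)
  refine (hf.hasDerivAt_comb_fst hx y ((hNx.mul_const y).div hhx hh) (hq.mul (hasDerivAt_C hx))
    (hNx.div hhx hh) (hq.mul (hasDerivAt_B hx))).congr_deriv ?_
  simp only [Pi.mul_apply, Pi.div_apply]
  rw [a1_eq, b1_eq, c1_eq, Ut, Wt, smul_comb, smul_comb, comb_add, kappa, q]
  clear hq hhx hNx hf
  have h1 := h_eq hx y
  have h2 := first_integral x
  have h3 := sqrt_five_sq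
  have h4 : N x = G x * (2 * X0 x - G x - x ^ 2 * G x + √5) := by
    rw [N, B]; linear_combination h2 + h3
  rw [h4] at hN ⊢
  rw [B]
  apply comb_congr
  all_goals
    generalize h x y = H at *
    field_simp
    grind

end

/-! ### Norms and inner products of the rotating pairs -/

section
variable {f : ℝ × ℝ → E4} {F : ℝ × ℝ → Fin 4 → E4} (hf : IsCurvatureSurface f F)
  {x : ℝ} (hx : 0 < x) (y : ℝ)
include hf hx

theorem IsCurvatureSurface.inner_U_U : inner ℝ (U F x y) (U F x y) = 1 + y ^ 2 := by
  rw [U, inner_comb (hf.orthonormal (x, y) hx)]; ring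

theorem IsCurvatureSurface.inner_U_W : inner ℝ (U F x y) (W F x y) = 0 := by
  rw [U, W, inner_comb (hf.orthonormal (x, y) hx)]; ring

theorem IsCurvatureSurface.inner_U_Ut : inner ℝ (U F x y) (Ut F x y) = 0 := by
  rw [U, Ut, inner_comb (hf.orthonormal (x, y) hx)]; ring

theorem IsCurvatureSurface.inner_U_Wt : inner ℝ (U F x y) (Wt F x y) = 0 := by
  rw [U, Wt, inner_comb (hf.orthonormal (x, y) hx)]; ring

theorem IsCurvatureSurface.inner_W_W : inner ℝ (W F x y) (W F x y) = 1 + y ^ 2 := by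
  have hh := (h_pos hx y).ne'
  have h1 := h_mul_G hx y
  rw [W, inner_comb (hf.orthonormal (x, y) hx), q]
  rw [N] at h1
  field_simp
  linear_combination -4 * (1 + y ^ 2) ^ 2 * h1

theorem IsCurvatureSurface.inner_W_Ut : inner ℝ (W F x y) (Ut F x y) = 0 := by
  rw [W, Ut, inner_comb (hf.orthonormal (x, y) hx)]; ring

theorem IsCurvatureSurface.inner_W_Wt : inner ℝ (W F x y) (Wt F x y) = 0 := by
  rw [W, Wt, inner_comb (hf.orthonormal (x, y) hx), N]; ring

theorem IsCurvatureSurface.inner_Ut_Ut : inner ℝ (Ut F x y) (Ut F x y) = N x := by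
  rw [Ut, inner_comb (hf.orthonormal (x, y) hx), N]; ring

theorem IsCurvatureSurface.inner_Ut_Wt : inner ℝ (Ut F x y) (Wt F x y) = 0 := by
  rw [Ut, Wt, inner_comb (hf.orthonormal (x, y) hx)]; ring

theorem IsCurvatureSurface.inner_Wt_Wt : inner ℝ (Wt F x y) (Wt F x y) = N x := by
  have hh := (h_pos hx y).ne'
  have h1 := h_mul_G hx y
  rw [Wt, inner_comb (hf.orthonormal (x, y) hx)]
  have h2 : q x y * C x * (q x y * C x) + q x y * B x * (q x y * B x) = q x y ^ 2 * N x := by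
    rw [N]; ring
  have h3 : 2 * N x * y / h x y * (2 * N x * y / h x y) + 2 * N x / h x y * (2 * N x / h x y) +
      q x y ^ 2 * N x = N x := by
    rw [q]
    field_simp
    linear_combination -4 * N x * (1 + y ^ 2) * h1
  linear_combination h2 + h3

end

/-! ### Rotating pairs -/

theorem inner_rotA_rotA {ρ τ M : ℝ} {U W : E4} (hU : inner ℝ U U = M) (hW : inner ℝ W W = M)
    (hUW : inner ℝ U W = 0) (hρ : ρ ^ 2 * M = 1) :
    inner ℝ (rotA ρ τ U W) (rotA ρ τ U W) = 1 := by
  have hWU : inner ℝ W U = 0 := by rw [real_inner_comm]; exact hUW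
  simp only [rotA, inner_smul_left, inner_smul_right, inner_sub_left, inner_sub_right, hU, hW, hUW,
    hWU, conj_trivial]
  linear_combination hρ + ρ ^ 2 * M * Real.sin_sq_add_cos_sq τ

theorem inner_rotB_rotB {ρ τ M : ℝ} {U W : E4} (hU : inner ℝ U U = M) (hW : inner ℝ W W = M)
    (hUW : inner ℝ U W = 0) (hρ : ρ ^ 2 * M = 1) :
    inner ℝ (rotB ρ τ U W) (rotB ρ τ U W) = 1 := by
  have hWU : inner ℝ W U = 0 := by rw [real_inner_comm]; exact hUW
  simp only [rotB, inner_smul_left, inner_smul_right, inner_add_left, inner_add_right, hU, hW, hUW,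
    hWU, conj_trivial]
  linear_combination hρ + ρ ^ 2 * M * Real.sin_sq_add_cos_sq τ

theorem inner_rotA_rotB {ρ τ M : ℝ} {U W : E4} (hU : inner ℝ U U = M) (hW : inner ℝ W W = M)
    (hUW : inner ℝ U W = 0) :
    inner ℝ (rotA ρ τ U W) (rotB ρ τ U W) = 0 := by
  have hWU : inner ℝ W U = 0 := by rw [real_inner_comm]; exact hUW
  simp only [rotA, rotB, inner_smul_left, inner_smul_right, inner_add_right,
    inner_sub_left, hU, hW, hUW, hWU, conj_trivial]
  ring

theorem inner_rotA_eq_zero {ρ τ : ℝ} {U W V : E4} (hU : inner ℝ U V = 0) (hW : inner ℝ W V = 0) :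
    inner ℝ (rotA ρ τ U W) V = 0 := by
  simp [rotA, inner_smul_left, inner_sub_left, hU, hW]

theorem inner_rotB_eq_zero {ρ τ : ℝ} {U W V : E4} (hU : inner ℝ U V = 0) (hW : inner ℝ W V = 0) :
    inner ℝ (rotB ρ τ U W) V = 0 := by
  simp [rotB, inner_smul_left, inner_add_left, hU, hW]

theorem cos_smul_rotB_sub_sin_smul_rotA (ρ τ : ℝ) (U W : E4) :
    Real.cos τ • rotB ρ τ U W - Real.sin τ • rotA ρ τ U W = ρ • U := by
  calc _ = (Real.sin τ ^ 2 + Real.cos τ ^ 2) • ρ • U := by rw [rotA, rotB]; module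
    _ = _ := by rw [Real.sin_sq_add_cos_sq, one_smul]

/-! ### The phase of `ũ` -/

theorem differentiable_kappa : Differentiable ℝ kappa := by
  intro x
  have h1 := (hasDerivAt_G' x).differentiableAt
  have h2 := (hasDerivAt_C' x).differentiableAt
  have h3 := (hasDerivAt_X0 x).differentiableAt
  have h4 : DifferentiableAt ℝ B x := ((h1.div_const 2).neg).sub_const √5
  have h5 : DifferentiableAt ℝ N x := (h4.pow 2).add (h2.pow 2)
  exact (h4.neg.mul (h3.add_const _)).div h5 (N_pos x).ne'

theorem N_zero : N 0 = (1 + √5) ^ 2 := by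
  rw [N, B, G_zero, C_zero]; ring

theorem kappa_zero : kappa 0 = √5 / 2 := by
  have := (N_pos 0).ne'
  rw [kappa, div_eq_iff this, N_zero, B, G_zero, X0_zero]
  linear_combination -(1 / 2 * √5 + 1 / 2) * sqrt_five_sq

/-- The bounded part of the phase of `ũ`. -/
def phaseErr (x : ℝ) : ℝ := ∫ t in (0 : ℝ)..x, dslope kappa 0 t

/-- The phase of `ũ`. -/
def phase (x : ℝ) : ℝ := √5 / 2 * Real.log x + phaseErr x

theorem continuous_dslope_kappa : Continuous (dslope kappa 0) := by
  rw [← continuousOn_univ, continuousOn_dslope Filter.univ_mem]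
  exact ⟨differentiable_kappa.continuous.continuousOn, differentiable_kappa 0⟩

theorem hasDerivAt_phaseErr (x : ℝ) : HasDerivAt phaseErr (dslope kappa 0 x) x :=
  continuous_dslope_kappa.integral_hasStrictDerivAt 0 x |>.hasDerivAt

theorem hasDerivAt_phase {x : ℝ} (hx : 0 < x) : HasDerivAt phase (kappa x / x) x := by
  refine (((Real.hasDerivAt_log hx.ne').const_mul (√5 / 2)).add
    (hasDerivAt_phaseErr x)).congr_deriv ?_
  rw [dslope_of_ne _ hx.ne', slope_def_field, kappa_zero, sub_zero]
  field_simp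
  ring

theorem phaseErr_zero : phaseErr 0 = 0 := by simp [phaseErr]

theorem hasDerivAt_inv_sqrt {M : ℝ → ℝ} {M' t : ℝ} (hM : HasDerivAt M M' t) (h0 : 0 < M t) :
    HasDerivAt (fun t => (√(M t))⁻¹) (-(M' / (2 * M t)) * (√(M t))⁻¹) t := by
  have h1 := Real.sqrt_pos.mpr h0
  refine ((hM.sqrt h0.ne').inv h1.ne').congr_deriv ?_
  have h2 := Real.sq_sqrt h0.le
  generalize √(M t) = s at *
  rw [← h2]
  field_simp

theorem inv_sqrt_sq_mul {M : ℝ} (h0 : 0 < M) : (√M)⁻¹ ^ 2 * M = 1 := by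
  rw [inv_pow, Real.sq_sqrt h0.le, inv_mul_cancel₀ h0.ne']

theorem eq_of_hasDerivAt_fst {g : ℝ → ℝ → E4} {y : ℝ}
    (hg : ∀ x, 0 < x → HasDerivAt (fun x => g x y) 0 x) {x : ℝ} (hx : 0 < x) :
    g x y = g 1 y := by
  refine isOpen_Ioi.is_const_of_deriv_eq_zero (convex_Ioi (0 : ℝ)).isPreconnected
    (fun t ht => (hg t ht).differentiableAt.differentiableWithinAt)
    (fun t ht => (hg t ht).deriv) hx (Set.mem_Ioi.mpr one_pos)

theorem eq_of_hasDerivAt_snd {g : ℝ → ℝ → E4} {x : ℝ}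
    (hg : ∀ y, HasDerivAt (fun y => g x y) 0 y) (y : ℝ) :
    g x y = g x 0 :=
  is_const_of_deriv_eq_zero (fun t => (hg t).differentiableAt) (fun t => (hg t).deriv) y 0

/-! ### The constant frame -/

theorem orthonormal_fin_four {e : Fin 4 → E4} (h00 : inner ℝ (e 0) (e 0) = 1)
    (h11 : inner ℝ (e 1) (e 1) = 1) (h22 : inner ℝ (e 2) (e 2) = 1)
    (h33 : inner ℝ (e 3) (e 3) = 1) (h01 : inner ℝ (e 0) (e 1) = 0)
    (h02 : inner ℝ (e 0) (e 2) = 0) (h03 : inner ℝ (e 0) (e 3) = 0)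
    (h12 : inner ℝ (e 1) (e 2) = 0) (h13 : inner ℝ (e 1) (e 3) = 0)
    (h23 : inner ℝ (e 2) (e 3) = 0) : Orthonormal ℝ e := by
  rw [orthonormal_iff_ite]
  have hs : ∀ {i j}, inner ℝ (e i) (e j) = 0 → inner ℝ (e j) (e i) = 0 :=
    fun h => (real_inner_comm _ _).trans h
  intro i j
  fin_cases i <;> fin_cases j
  · exact h00
  · exact h01
  · exact h02
  · exact h03
  · exact hs h01
  · exact h11
  · exact h12
  · exact h13
  · exact hs h02
  · exact hs h12
  · exact h22
  · exact h23
  · exact hs h03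
  · exact hs h13
  · exact hs h23
  · exact h33


theorem hasDerivAt_sub_arctan (y : ℝ) :
    HasDerivAt (fun y => y - Real.arctan y) (y ^ 2 / (1 + y ^ 2)) y := by
  refine ((hasDerivAt_id y).sub (Real.hasDerivAt_arctan y)).congr_deriv ?_
  field_simp
  ring

/-- The four vectors of the constant frame, computed at `(x, y)`. -/
def frameAt (F : ℝ × ℝ → Fin 4 → E4) (x y : ℝ) : Fin 4 → E4 :=
  ![rotB (√(N x))⁻¹ (-phase x) (Ut F x y) (Wt F x y),
    rotA (√(N x))⁻¹ (-phase x) (Ut F x y) (Wt F x y),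
    rotA (√(1 + y ^ 2))⁻¹ (y - Real.arctan y) (U F x y) (W F x y),
    rotB (√(1 + y ^ 2))⁻¹ (y - Real.arctan y) (U F x y) (W F x y)]

theorem hasDerivAt_rotA_zero {U W : ℝ → E4} {t : ℝ} (ρ τ : ℝ) (hU : HasDerivAt U 0 t)
    (hW : HasDerivAt W 0 t) : HasDerivAt (fun t => rotA ρ τ (U t) (W t)) 0 t := by
  refine (((hW.const_smul (Real.cos τ)).sub (hU.const_smul (Real.sin τ))).const_smul
    ρ).congr_deriv ?_
  simp

theorem hasDerivAt_rotB_zero {U W : ℝ → E4} {t : ℝ} (ρ τ : ℝ) (hU : HasDerivAt U 0 t)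
    (hW : HasDerivAt W 0 t) : HasDerivAt (fun t => rotB ρ τ (U t) (W t)) 0 t := by
  refine (((hW.const_smul (Real.sin τ)).add (hU.const_smul (Real.cos τ))).const_smul
    ρ).congr_deriv ?_
  simp

section
variable {f : ℝ × ℝ → E4} {F : ℝ × ℝ → Fin 4 → E4} (hf : IsCurvatureSurface f F)
  {x : ℝ} (hx : 0 < x) (y : ℝ)
include hf hx

theorem IsCurvatureSurface.hasDerivAt_frameAt_fst (i : Fin 4) :
    HasDerivAt (fun x => frameAt F x y i) 0 x := by
  have hρ := hasDerivAt_inv_sqrt (hasDerivAt_N hx) (N_pos x)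
  have hτ := (hasDerivAt_phase hx).neg
  have hU := hf.hasDerivAt_U_fst hx y
  have hW := hf.hasDerivAt_W_fst hx y
  have hUt := hf.hasDerivAt_Ut_fst hx y
  have hWt := hf.hasDerivAt_Wt_fst hx y
  fin_cases i
  · exact hasDerivAt_rotB hρ hτ hUt hWt
  · exact hasDerivAt_rotA hρ hτ hUt hWt
  · exact hasDerivAt_rotA_zero _ _ hU hW
  · exact hasDerivAt_rotB_zero _ _ hU hW

theorem IsCurvatureSurface.hasDerivAt_frameAt_snd (i : Fin 4) :
    HasDerivAt (fun y => frameAt F x y i) 0 y := by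
  have hρ : HasDerivAt (fun y : ℝ => (√(1 + y ^ 2))⁻¹)
      (-(y / (1 + y ^ 2)) * (√(1 + y ^ 2))⁻¹) y := by
    refine (hasDerivAt_inv_sqrt ((hasDerivAt_pow 2 y).const_add 1)
      (by positivity)).congr_deriv ?_
    push_cast
    field_simp
  have hτ := hasDerivAt_sub_arctan y
  have hU := hf.hasDerivAt_U_snd hx y
  have hW := hf.hasDerivAt_W_snd hx y
  have hUt := hf.hasDerivAt_Ut_snd hx y
  have hWt := hf.hasDerivAt_Wt_snd hx y
  fin_cases i
  · exact hasDerivAt_rotB_zero _ _ hUt hWt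
  · exact hasDerivAt_rotA_zero _ _ hUt hWt
  · exact hasDerivAt_rotA hρ hτ hU hW
  · exact hasDerivAt_rotB hρ hτ hU hW

theorem IsCurvatureSurface.frameAt_eq : frameAt F x y = frameAt F 1 0 := by
  ext1 i
  rw [eq_of_hasDerivAt_fst (g := fun x y => frameAt F x y i)
    (fun t ht => hf.hasDerivAt_frameAt_fst ht y i) hx]
  exact eq_of_hasDerivAt_snd (g := fun x y => frameAt F x y i)
    (fun t => hf.hasDerivAt_frameAt_snd one_pos t i) y

theorem IsCurvatureSurface.orthonormal_frameAt : Orthonormal ℝ (frameAt F x y) := by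
  have hy : (0 : ℝ) < 1 + y ^ 2 := by positivity
  have h1 := hf.inner_U_Ut hx y
  have h2 := hf.inner_U_Wt hx y
  have h3 := hf.inner_W_Ut hx y
  have h4 := hf.inner_W_Wt hx y
  have hUU := hf.inner_U_U hx y
  have hWW := hf.inner_W_W hx y
  have hUW := hf.inner_U_W hx y
  have hUUt := hf.inner_Ut_Ut hx y
  have hWWt := hf.inner_Wt_Wt hx y
  have hUWt := hf.inner_Ut_Wt hx y
  have hcross : ∀ V ∈ ({U F x y, W F x y} : Set E4), ∀ i : Fin 4, (i = 0 ∨ i = 1) →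
      inner ℝ (frameAt F x y i) V = 0 := by
    rintro V (rfl | rfl) i (rfl | rfl)
    · exact inner_rotB_eq_zero ((real_inner_comm _ _).trans h1) ((real_inner_comm _ _).trans h2)
    · exact inner_rotA_eq_zero ((real_inner_comm _ _).trans h1) ((real_inner_comm _ _).trans h2)
    · exact inner_rotB_eq_zero ((real_inner_comm _ _).trans h3) ((real_inner_comm _ _).trans h4)
    · exact inner_rotA_eq_zero ((real_inner_comm _ _).trans h3) ((real_inner_comm _ _).trans h4)
  have hc : ∀ i j : Fin 4, (i = 0 ∨ i = 1) → (j = 2 ∨ j = 3) →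
      inner ℝ (frameAt F x y j) (frameAt F x y i) = 0 := by
    rintro i j hi (rfl | rfl)
    · exact inner_rotA_eq_zero ((real_inner_comm _ _).trans (hcross _ (by simp) i hi))
        ((real_inner_comm _ _).trans (hcross _ (by simp) i hi))
    · exact inner_rotB_eq_zero ((real_inner_comm _ _).trans (hcross _ (by simp) i hi))
        ((real_inner_comm _ _).trans (hcross _ (by simp) i hi))
  have h01 : inner ℝ (frameAt F x y 1) (frameAt F x y 0) = 0 := inner_rotA_rotB hUUt hWWt hUWt
  have h23 : inner ℝ (frameAt F x y 2) (frameAt F x y 3) = 0 := inner_rotA_rotB hUU hWW hUW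
  have h00 : inner ℝ (frameAt F x y 0) (frameAt F x y 0) = 1 :=
    inner_rotB_rotB hUUt hWWt hUWt (inv_sqrt_sq_mul (N_pos x))
  have h11 : inner ℝ (frameAt F x y 1) (frameAt F x y 1) = 1 :=
    inner_rotA_rotA hUUt hWWt hUWt (inv_sqrt_sq_mul (N_pos x))
  have h22 : inner ℝ (frameAt F x y 2) (frameAt F x y 2) = 1 :=
    inner_rotA_rotA hUU hWW hUW (inv_sqrt_sq_mul hy)
  have h33 : inner ℝ (frameAt F x y 3) (frameAt F x y 3) = 1 :=
    inner_rotB_rotB hUU hWW hUW (inv_sqrt_sq_mul hy)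
  exact orthonormal_fin_four h00 h11 h22 h33 ((real_inner_comm _ _).trans h01)
    ((real_inner_comm _ _).trans (hc 0 2 (by simp) (by simp)))
    ((real_inner_comm _ _).trans (hc 0 3 (by simp) (by simp)))
    ((real_inner_comm _ _).trans (hc 1 2 (by simp) (by simp)))
    ((real_inner_comm _ _).trans (hc 1 3 (by simp) (by simp))) h23

end

/-! ### The asymptotic frame -/

theorem exists_sub_arctan_sin_ne_zero : Real.sin ((1 : ℝ) - Real.arctan 1) ≠ 0 := by
  rw [Real.arctan_one]
  refine (Real.sin_pos_of_pos_of_lt_pi ?_ ?_).ne' <;> nlinarith [Real.pi_gt_three, Real.pi_lt_four]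

/-- The distance of `X_α` from its asymptotic rotation is at most `asympErr`. -/
def asympErr (x : ℝ) : ℝ :=
  |1 + (√(N x))⁻¹ * B x| + |(√(N x))⁻¹ * C x| + |phaseErr x| + |phaseErr x|

theorem tendsto_asympErr : Tendsto (fun t => asympErr (Real.exp (-t))) atTop (𝓝 0) := by
  have h1 := (hasDerivAt_G' 0).continuousAt
  have h2 := (hasDerivAt_C' 0).continuousAt
  have h4 : ContinuousAt B 0 := (h1.div_const 2).neg.sub continuousAt_const
  have h5 : ContinuousAt N 0 := (h4.pow 2).add (h2.pow 2)
  have h6 : ContinuousAt (fun x => (√(N x))⁻¹) 0 :=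
    h5.sqrt.inv₀ (Real.sqrt_pos.mpr (N_pos 0)).ne'
  have h7 := (hasDerivAt_phaseErr 0).continuousAt
  have h8 : ContinuousAt asympErr 0 :=
    ((((continuousAt_const.add (h6.mul h4)).abs).add (h6.mul h2).abs).add h7.abs).add h7.abs
  have h9 : asympErr 0 = 0 := by
    have h10 : √(N 0) = 1 + √5 := by
      rw [N_zero, Real.sqrt_sq (by positivity)]
    have h11 : (1 + √5 : ℝ) ≠ 0 := by positivity
    have h12 : 1 + (1 + √5)⁻¹ * B 0 = 0 := by
      rw [B, G_zero]
      field_simp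
      ring
    rw [asympErr, h10, h12, C_zero, phaseErr_zero]
    simp
  have h10 : Tendsto (fun t => Real.exp (-t)) atTop (𝓝 0) :=
    Real.tendsto_exp_neg_atTop_nhds_zero
  have := h8.tendsto.comp h10
  rwa [h9] at this

theorem phase_exp (t : ℝ) :
    phase (Real.exp (-t)) = -(√5 * t / 2) + phaseErr (Real.exp (-t)) := by
  rw [phase, Real.log_exp]; ring

section
variable {f : ℝ × ℝ → E4} {F : ℝ × ℝ → Fin 4 → E4}

theorem uVec_eq (x y : ℝ) : uVec F (x, y) = (√(1 + y ^ 2))⁻¹ • U F x y := by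
  rw [uVec, U, comb]; module

theorem utVec_eq {x : ℝ} (hx : 0 < x) (y : ℝ) :
    utVec F (x, y) = (√(N x))⁻¹ • Ut F x y := by
  rw [utVec, Ut, comb, B2_eq hx, C2_eq hx, N]; module

theorem IsCurvatureSurface.norm_frame_sub_le (hf : IsCurvatureSurface f F) (t y : ℝ) :
    ‖F (Real.exp (-t), y) 1 - (Real.cos (√5 * t / 2) • frameAt F 1 0 0 -
      Real.sin (√5 * t / 2) • frameAt F 1 0 1)‖ ≤ asympErr (Real.exp (-t)) := by
  have hx := Real.exp_pos (-t)
  have hph := phase_exp t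
  set x := Real.exp (-t)
  have hon := hf.orthonormal (x, y) hx
  have hoe := hf.orthonormal_frameAt one_pos 0
  have h1 := cos_smul_rotB_sub_sin_smul_rotA (√(N x))⁻¹ (-phase x) (Ut F x y) (Wt F x y)
  have h0 : rotB (√(N x))⁻¹ (-phase x) (Ut F x y) (Wt F x y) = frameAt F 1 0 0 :=
    congrFun (hf.frameAt_eq hx y) 0
  have h0' : rotA (√(N x))⁻¹ (-phase x) (Ut F x y) (Wt F x y) = frameAt F 1 0 1 :=
    congrFun (hf.frameAt_eq hx y) 1
  rw [h0, h0'] at h1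
  have h2 : F (x, y) 1 - (Real.cos (√5 * t / 2) • frameAt F 1 0 0 -
      Real.sin (√5 * t / 2) • frameAt F 1 0 1) =
      (1 + (√(N x))⁻¹ * B x) • F (x, y) 1 - ((√(N x))⁻¹ * C x) • F (x, y) 3 +
      (Real.cos (-phase x) - Real.cos (√5 * t / 2)) • frameAt F 1 0 0 -
      (Real.sin (-phase x) - Real.sin (√5 * t / 2)) • frameAt F 1 0 1 := by
    have h3 : (√(N x))⁻¹ • Ut F x y =
        -((√(N x))⁻¹ * B x) • F (x, y) 1 + ((√(N x))⁻¹ * C x) • F (x, y) 3 := by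
      rw [Ut, comb]; module
    rw [h3] at h1
    linear_combination (norm := module) (-1 : ℝ) • h1
  have h4 : |(-phase x) - √5 * t / 2| = |phaseErr x| := by
    rw [hph, ← abs_neg]; congr 1; ring
  have h5 := (Real.abs_cos_sub_cos_le (-phase x) (√5 * t / 2)).trans_eq h4
  have h6 := (Real.abs_sin_sub_sin_le (-phase x) (√5 * t / 2)).trans_eq h4
  rw [h2, asympErr]
  refine (norm_sub_le _ _).trans (add_le_add ((norm_add_le _ _).trans (add_le_add
    ((norm_sub_le _ _).trans (add_le_add ?_ ?_)) ?_)) ?_)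
  · rw [norm_smul, hon.1 1, mul_one, Real.norm_eq_abs]
  · rw [norm_smul, hon.1 3, mul_one, Real.norm_eq_abs]
  · rw [norm_smul, hoe.1 0, mul_one, Real.norm_eq_abs]; exact h5
  · rw [norm_smul, hoe.1 1, mul_one, Real.norm_eq_abs]; exact h6

theorem IsCurvatureSurface.isAsymptoticFrame (hf : IsCurvatureSurface f F) :
    IsAsymptoticFrame F (frameAt F 1 0) where
  orthonormal := hf.orthonormal_frameAt one_pos 0
  limit := by
    rw [Metric.tendstoUniformly_iff]
    intro ε hε
    filter_upwards [tendsto_asympErr.eventually_lt_const hε] with t ht y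
    rw [dist_zero_left]
    exact (hf.norm_frame_sub_le t y).trans_lt ht
  rotation := by
    rintro ⟨x, y⟩ hx
    rw [← hf.frameAt_eq hx y, uVec_eq, ← cos_smul_rotB_sub_sin_smul_rotA (√(1 + y ^ 2))⁻¹
      (y - Real.arctan y) (U F x y) (W F x y), neg_smul, neg_add_eq_sub]
    rfl

theorem IsAsymptoticFrame.unique {e e' : Fin 4 → E4} (he : IsAsymptoticFrame F e)
    (he' : IsAsymptoticFrame F e') : e = e' := by
  have h3 : e 3 = e' 3 := by
    have h1 := (he.rotation (1, 0) (zero_lt_one' ℝ)).symm.trans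
      (he'.rotation (1, 0) (zero_lt_one' ℝ))
    simpa using h1
  have h2 : e 2 = e' 2 := by
    have h1 := (he.rotation (1, 1) (zero_lt_one' ℝ)).symm.trans
      (he'.rotation (1, 1) (zero_lt_one' ℝ))
    rw [h3] at h1
    exact smul_right_injective E4 (neg_ne_zero.mpr exists_sub_arctan_sin_ne_zero)
      (add_right_cancel h1)
  have hlim : Tendsto (fun t : ℝ => Real.cos (√5 * t / 2) • (e 0 - e' 0) -
      Real.sin (√5 * t / 2) • (e 1 - e' 1)) atTop (𝓝 0) := by
    have h1 := (he'.limit.tendsto_at 0).sub (he.limit.tendsto_at 0)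
    rw [sub_zero] at h1
    refine h1.congr fun t => ?_
    module
  have h5 : (√5 : ℝ) ≠ 0 := sqrt_five_pos.ne'
  have hseq : ∀ c : ℝ, Tendsto (fun n : ℕ => 2 / √5 * (n * (2 * Real.pi) + c)) atTop atTop := by
    intro c
    refine Tendsto.const_mul_atTop (by positivity) (tendsto_atTop_add_const_right _ _ ?_)
    exact tendsto_natCast_atTop_atTop.atTop_mul_const (by positivity)
  have hang : ∀ (c : ℝ) (n : ℕ),
      √5 * (2 / √5 * (n * (2 * Real.pi) + c)) / 2 = c + n * (2 * Real.pi) := by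
    intro c n
    field_simp
    ring
  have h0 : e 0 = e' 0 := by
    have h1 := hlim.comp (hseq 0)
    have h4 := h1.congr (f₂ := fun _ => e 0 - e' 0) fun n => by
      simp only [Function.comp, hang, Real.cos_add_nat_mul_two_pi, Real.sin_add_nat_mul_two_pi]
      simp
    exact sub_eq_zero.mp (tendsto_nhds_unique tendsto_const_nhds h4)
  have h1 : e 1 = e' 1 := by
    have h1 := hlim.comp (hseq (Real.pi / 2))
    have h4 := h1.congr (f₂ := fun _ => -(e 1 - e' 1)) fun n => by
      simp only [Function.comp, hang, Real.cos_add_nat_mul_two_pi, Real.sin_add_nat_mul_two_pi]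
      simp
    exact sub_eq_zero.mp (neg_eq_zero.mp (tendsto_nhds_unique tendsto_const_nhds h4))
  ext1 i
  fin_cases i
  · exact h0
  · exact h1
  · exact h2
  · exact h3

end

/-! ### The centre curves -/

/-- The centre of the sphere `S²_y`, computed at `(x, y)`. -/
def centreX (f : ℝ × ℝ → E4) (F : ℝ × ℝ → Fin 4 → E4) (x y : ℝ) : E4 :=
  f (x, y) - radX y • fVec F (x, y)

/-- The centre of the sphere `S²_x`, computed at `(x, y)`. -/
def centreY (f : ℝ × ℝ → E4) (F : ℝ × ℝ → Fin 4 → E4) (x y : ℝ) : E4 :=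
  f (x, y) - radY x • ftVec F (x, y)

section
variable {f : ℝ × ℝ → E4} {F : ℝ × ℝ → Fin 4 → E4}

theorem fVec_eq (x y : ℝ) : fVec F (x, y) = (√((1 + y ^ 2) * (5 + 4 * y ^ 2)))⁻¹ •
    comb F (x, y) y 0 1 (-(2 * (1 + y ^ 2))) := by
  rw [fVec, comb]; module

theorem ftVec_eq {x : ℝ} (hx : 0 < x) (y : ℝ) : ftVec F (x, y) = (√(N x))⁻¹ •
    comb F (x, y) 0 (C x) 0 (B x) := by
  rw [ftVec, comb, B2_eq hx, C2_eq hx, N]; module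

theorem centreX_eq (x y : ℝ) : centreX f F x y = f (x, y) -
    comb F (x, y) (y / (2 * √5 * (1 + y ^ 2))) 0 (1 / (2 * √5 * (1 + y ^ 2))) (-(1 / √5)) := by
  have h5 := sqrt_five_pos
  have h1 : (0 : ℝ) < 1 + y ^ 2 := by positivity
  have h2 : (0 : ℝ) < 5 + 4 * y ^ 2 := by positivity
  have h3 := Real.sqrt_pos.mpr h1
  have h4 := Real.sqrt_pos.mpr h2
  have h6 : radX y * (√((1 + y ^ 2) * (5 + 4 * y ^ 2)))⁻¹ = 1 / (2 * √5 * (1 + y ^ 2)) := by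
    rw [radX, Real.sqrt_div h2.le, Real.sqrt_mul h1.le]
    have h7 := Real.sq_sqrt h1.le
    generalize √(1 + y ^ 2) = s at *
    rw [← h7]
    field_simp
  rw [centreX, fVec_eq, smul_smul, h6, smul_comb]
  congr 1
  apply comb_congr <;> (field_simp; try simp)

theorem radY_eq {x : ℝ} (hx : 0 < x) : radY x = (√(N x))⁻¹ := by
  rw [radY, B2_eq hx, C2_eq hx, N]

theorem centreY_eq {x : ℝ} (hx : 0 < x) (y : ℝ) : centreY f F x y = f (x, y) -
    comb F (x, y) 0 (C x / N x) 0 (B x / N x) := by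
  have h1 : (√(N x))⁻¹ * (√(N x))⁻¹ = (N x)⁻¹ := by
    rw [← mul_inv, Real.mul_self_sqrt (N_pos x).le]
  rw [centreY, ftVec_eq hx, radY_eq hx, smul_smul, h1, smul_comb]
  congr 1
  apply comb_congr <;> ring

theorem hasDerivAt_centre_X_coeff (y : ℝ) : HasDerivAt (fun y : ℝ => 1 / (2 * √5 * (1 + y ^ 2)))
    (-(y / (√5 * (1 + y ^ 2) ^ 2))) y := by
  have h5 := sqrt_five_pos
  refine ((hasDerivAt_const y 1).div (((hasDerivAt_pow 2 y).const_add 1).const_mul (2 * √5))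
    (by positivity)).congr_deriv ?_
  push_cast
  field_simp
  ring

variable (hf : IsCurvatureSurface f F) {x : ℝ} (hx : 0 < x) (y : ℝ)
include hf hx

theorem IsCurvatureSurface.hasDerivAt_centreX_fst :
    HasDerivAt (fun x => centreX f F x y) 0 x := by
  have hh := (h_pos hx y).ne'
  have h5 := sqrt_five_pos
  simp only [centreX_eq]
  refine ((hf.hasDerivAt_surface_fst hx y).sub (hf.hasDerivAt_comb_fst hx y
    (hasDerivAt_const x _) (hasDerivAt_const x _) (hasDerivAt_const x _)
    (hasDerivAt_const x _))).congr_deriv ?_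
  rw [← comb_zero F (x, y), comb_sub, a1_eq, b1_eq, c1_eq]
  apply comb_congr
  all_goals
    generalize h x y = H at *
    field_simp
    ring

theorem IsCurvatureSurface.hasDerivAt_centreX_snd :
    HasDerivAt (fun y => centreX f F x y) ((y / (2 * √5 * (1 + y ^ 2) ^ 2)) • W F x y -
      (y ^ 2 / (2 * √5 * (1 + y ^ 2) ^ 2)) • U F x y) y := by
  have hh := (h_pos hx y).ne'
  have h5 := sqrt_five_pos
  have h6 := hasDerivAt_centre_X_coeff y
  have h7 : HasDerivAt (fun y : ℝ => y / (2 * √5 * (1 + y ^ 2)))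
      (1 / (2 * √5 * (1 + y ^ 2)) - y * (y / (√5 * (1 + y ^ 2) ^ 2))) y := by
    refine ((hasDerivAt_id y).mul h6).congr_deriv ?_ |>.congr_of_eventuallyEq
      (Eventually.of_forall fun t => ?_)
    · simp only [id]; ring
    · simp only [id, Pi.mul_apply]; ring
  simp only [centreX_eq]
  refine ((hf.hasDerivAt_surface_snd hx y).sub (hf.hasDerivAt_comb_snd hx y
    h7 (hasDerivAt_const y _) h6
    (hasDerivAt_const y _))).congr_deriv ?_
  rw [comb_sub, a2_eq hx, b2_eq hx, c2_eq hx, U, W, smul_comb, smul_comb, comb_sub, q, B]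
  clear hf h6 h7
  have h3 := sqrt_five_sq
  apply comb_congr
  all_goals
    generalize h x y = H at *
    field_simp
    grind

theorem IsCurvatureSurface.hasDerivAt_centreY_snd :
    HasDerivAt (fun y => centreY f F x y) 0 y := by
  have hh := (h_pos hx y).ne'
  have hN := (N_pos x).ne'
  simp only [centreY_eq hx]
  refine ((hf.hasDerivAt_surface_snd hx y).sub (hf.hasDerivAt_comb_snd hx y
    (hasDerivAt_const y _) (hasDerivAt_const y _) (hasDerivAt_const y _)
    (hasDerivAt_const y _))).congr_deriv ?_
  rw [← comb_zero F (x, y), comb_sub, a2_eq hx, b2_eq hx, c2_eq hx]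
  have h1 : N x = B x ^ 2 + C x ^ 2 := rfl
  apply comb_congr
  all_goals
    generalize h x y = H at *
    field_simp
    grind

theorem IsCurvatureSurface.hasDerivAt_centreY_fst :
    HasDerivAt (fun x => centreY f F x y)
      ((-(C x * (X0 x + √5 / 2)) / (x * N x ^ 2)) • Wt F x y +
        (-(B x * ((X0 x + √5 / 2) / N x - 1 / G x)) / (x * N x)) • Ut F x y) x := by
  have hh := (h_pos hx y).ne'
  have hN := (N_pos x).ne'
  have hG := (G_pos x).ne'
  have hNx := hasDerivAt_N hx
  have hC := (hasDerivAt_C hx).div hNx hN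
  have hB := (hasDerivAt_B hx).div hNx hN
  have h1 := (hf.hasDerivAt_surface_fst hx y).sub (hf.hasDerivAt_comb_fst hx y
    (hasDerivAt_const x 0) hC (hasDerivAt_const x 0) hB)
  refine (h1.congr_deriv ?_).congr_of_eventuallyEq ?_
  · simp only [Pi.div_apply]
    rw [comb_sub, a1_eq, b1_eq, c1_eq, Ut, Wt, smul_comb, smul_comb, comb_add, q]
    clear hNx hC hB h1 hf
    have h1 := h_eq hx y
    have h2 := first_integral x
    have h3 := sqrt_five_sq
    have h4 : N x = G x * (2 * X0 x - G x - x ^ 2 * G x + √5) := by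
      rw [N, B]; linear_combination h2 + h3
    obtain ⟨M, hM⟩ : ∃ M, M = 2 * X0 x - G x - x ^ 2 * G x + √5 := ⟨_, rfl⟩
    have hX : X0 x = (M + G x + x ^ 2 * G x - √5) / 2 := by rw [hM]; ring
    rw [← hM] at h4
    rw [h4] at hN ⊢
    have hM0 : M ≠ 0 := right_ne_zero_of_mul hN
    rw [hX] at h1 h2 ⊢
    rw [B]
    clear hM hX h4 hN
    apply comb_congr
    all_goals
      generalize h x y = H at *
      field_simp
      grind
  · filter_upwards [lt_mem_nhds hx] with t ht using centreY_eq ht y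

end

section
variable {f : ℝ × ℝ → E4} {F : ℝ × ℝ → Fin 4 → E4}

theorem radX_nonneg (y : ℝ) : 0 ≤ radX y := by
  rw [radX]; positivity

theorem radY_nonneg (x : ℝ) : 0 ≤ radY x := by
  rw [radY]; positivity

theorem norm_eq_one_of_inner_self {v : E4} (hv : inner ℝ v v = (1 : ℝ)) : ‖v‖ = 1 := by
  rw [real_inner_self_eq_norm_sq] at hv
  exact (pow_eq_one_iff_of_nonneg (norm_nonneg v) two_ne_zero).mp hv

theorem mem_twoSphere {c n v : E4} {r : ℝ} (hr : 0 ≤ r) (hv : inner ℝ v v = (1 : ℝ))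
    (hn : inner ℝ v n = (0 : ℝ)) {p : E4} (hp : p = r • v + c) : p ∈ twoSphere c n r := by
  have h1 := norm_eq_one_of_inner_self hv
  constructor
  · rw [dist_eq_norm, hp, add_sub_cancel_right, norm_smul, h1, mul_one, Real.norm_of_nonneg hr]
  · rw [hp, add_sub_cancel_right, inner_smul_left, hn, mul_zero]

theorem inner_inv_sqrt_smul {v : E4} {M : ℝ} (hM : 0 < M) (hv : inner ℝ v v = M) :
    inner ℝ ((√M)⁻¹ • v) ((√M)⁻¹ • v) = (1 : ℝ) := by
  rw [inner_smul_left, inner_smul_right, hv, conj_trivial]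
  linear_combination inv_sqrt_sq_mul hM

theorem IsCurvatureSurface.isCentreCurveX (hf : IsCurvatureSurface f F) :
    IsCentreCurveX f F (centreX f F 1) := by
  have hc : ∀ x, 0 < x → ∀ y, f (x, y) = radX y • fVec F (x, y) + centreX f F 1 y := by
    intro x hx y
    rw [← eq_of_hasDerivAt_fst (fun t ht => hf.hasDerivAt_centreX_fst ht y) hx, centreX,
      add_sub_cancel]
  have hu : ∀ x, 0 < x → ∀ y, inner ℝ (uVec F (x, y)) (uVec F (x, y)) = (1 : ℝ) := by
    intro x hx y
    rw [uVec_eq]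
    exact inner_inv_sqrt_smul (by positivity) (hf.inner_U_U hx y)
  refine ⟨fun p hp => hc p.1 hp p.2, fun y => ⟨uVec F (1, y), ?_, fun x hx => ?_⟩⟩
  · exact norm_eq_one_of_inner_self (hu 1 one_pos y)
  have huc : uVec F (x, y) = uVec F (1, y) := by
    rw [uVec_eq, uVec_eq]
    congr 1
    exact eq_of_hasDerivAt_fst (fun t ht => hf.hasDerivAt_U_fst ht y) hx
  refine ⟨huc, mem_twoSphere (radX_nonneg y) ?_ ?_ (hc x hx y)⟩
  · rw [fVec_eq]
    refine inner_inv_sqrt_smul (by positivity) ?_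
    rw [inner_comb (hf.orthonormal (x, y) hx)]
    ring
  · rw [← huc, fVec_eq, uVec_eq, U, inner_smul_left, inner_smul_right,
      inner_comb (hf.orthonormal (x, y) hx)]
    ring

theorem IsCurvatureSurface.isCentreCurveY (hf : IsCurvatureSurface f F) :
    IsCentreCurveY f F (fun x => centreY f F (x : ℝ) 0) := by
  have hc : ∀ x, 0 < x → ∀ y, f (x, y) = radY x • ftVec F (x, y) + centreY f F x 0 := by
    intro x hx y
    rw [← eq_of_hasDerivAt_snd (fun t => hf.hasDerivAt_centreY_snd hx t) y, centreY,
      add_sub_cancel]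
  refine ⟨fun x y => hc x x.2 y, fun ⟨x, hx⟩ => ⟨utVec F (x, 0), ?_, fun y => ?_⟩⟩
  · rw [utVec_eq hx]
    exact norm_eq_one_of_inner_self (inner_inv_sqrt_smul (N_pos x) (hf.inner_Ut_Ut hx 0))
  have huc : utVec F (x, y) = utVec F (x, 0) := by
    rw [utVec_eq hx, utVec_eq hx]
    congr 1
    exact eq_of_hasDerivAt_snd (fun t => hf.hasDerivAt_Ut_snd hx t) y
  refine ⟨huc, mem_twoSphere (radY_nonneg x) ?_ ?_ (hc x hx y)⟩
  · rw [ftVec_eq hx]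
    refine inner_inv_sqrt_smul (N_pos x) ?_
    rw [inner_comb (hf.orthonormal (x, y) hx), N]
    ring
  · rw [← huc, ftVec_eq hx, utVec_eq hx, Ut, inner_smul_left, inner_smul_right,
      inner_comb (hf.orthonormal (x, y) hx)]
    ring

theorem IsCentreCurveX.eq_centreX {A : ℝ → E4} (hA : IsCentreCurveX f F A) :
    A = centreX f F 1 := by
  ext1 y
  rw [centreX, hA.expansion (1, y) (zero_lt_one' ℝ), add_sub_cancel_left]

theorem IsCentreCurveY.eq_centreY {At : Set.Ioi (0 : ℝ) → E4} (hA : IsCentreCurveY f F At) :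
    At = fun x : Set.Ioi (0 : ℝ) => centreY f F x 0 := by
  ext1 x
  rw [centreY, hA.expansion x 0, add_sub_cancel_left]

/-! ### The planes of the centre curves -/

theorem sum_inner_smul_of_orthonormal {e : Fin 4 → E4} (he : Orthonormal ℝ e) (v : E4) :
    inner ℝ (e 0) v • e 0 + inner ℝ (e 1) v • e 1 + inner ℝ (e 2) v • e 2 +
      inner ℝ (e 3) v • e 3 = v := by
  have hcard : Fintype.card (Fin 4) = Module.finrank ℝ E4 := by simp
  let b := (basisOfOrthonormalOfCardEqFinrank he hcard).toOrthonormalBasis (by simpa using he)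
  have hb : ⇑b = e := by simp [b]
  have := b.sum_repr' v
  rw [hb] at this
  simpa [Fin.sum_univ_four] using this

theorem inner_eq_of_hasDerivAt {g g' : ℝ → E4} {v : E4} {s : Set ℝ} (hs : IsOpen s)
    (hc : Convex ℝ s) (hg : ∀ t ∈ s, HasDerivAt g (g' t) t)
    (hv : ∀ t ∈ s, inner ℝ v (g' t) = (0 : ℝ)) {t₁ t₂ : ℝ} (h₁ : t₁ ∈ s) (h₂ : t₂ ∈ s) :
    inner ℝ v (g t₁ - g t₂) = (0 : ℝ) := by
  have hd : ∀ t ∈ s, HasDerivAt (fun t => inner ℝ v (g t)) (0 : ℝ) t := by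
    intro t ht
    refine ((hasDerivAt_const t v).inner ℝ (hg t ht)).congr_deriv ?_
    rw [hv t ht, inner_zero_left, add_zero]
  rw [inner_sub_right, sub_eq_zero]
  exact hs.is_const_of_deriv_eq_zero hc.isPreconnected
    (fun t ht => (hd t ht).differentiableAt.differentiableWithinAt)
    (fun t ht => (hd t ht).deriv) h₁ h₂

variable (hf : IsCurvatureSurface f F)
include hf

theorem IsCurvatureSurface.inner_frame_eq_zero_left {x : ℝ} (hx : 0 < x) (y : ℝ) (a b : ℝ)
    {i : Fin 4} (hi : i = 0 ∨ i = 1) :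
    inner ℝ (frameAt F 1 0 i) (a • W F x y - b • U F x y) = (0 : ℝ) := by
  have h1 := (real_inner_comm _ _).trans (hf.inner_U_Ut hx y)
  have h2 := (real_inner_comm _ _).trans (hf.inner_U_Wt hx y)
  have h3 := (real_inner_comm _ _).trans (hf.inner_W_Ut hx y)
  have h4 := (real_inner_comm _ _).trans (hf.inner_W_Wt hx y)
  rw [← hf.frameAt_eq hx y, inner_sub_right, inner_smul_right, inner_smul_right]
  rcases hi with rfl | rfl
  · have hU : inner ℝ (frameAt F x y 0) (U F x y) = 0 := inner_rotB_eq_zero h1 h2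
    have hW : inner ℝ (frameAt F x y 0) (W F x y) = 0 := inner_rotB_eq_zero h3 h4
    rw [hU, hW]; ring
  · have hU : inner ℝ (frameAt F x y 1) (U F x y) = 0 := inner_rotA_eq_zero h1 h2
    have hW : inner ℝ (frameAt F x y 1) (W F x y) = 0 := inner_rotA_eq_zero h3 h4
    rw [hU, hW]; ring

theorem IsCurvatureSurface.inner_frame_eq_zero_right {x : ℝ} (hx : 0 < x) (y : ℝ) (a b : ℝ)
    {i : Fin 4} (hi : i = 2 ∨ i = 3) :
    inner ℝ (frameAt F 1 0 i) (a • Wt F x y + b • Ut F x y) = (0 : ℝ) := by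
  have h1 := hf.inner_U_Ut hx y
  have h2 := hf.inner_U_Wt hx y
  have h3 := hf.inner_W_Ut hx y
  have h4 := hf.inner_W_Wt hx y
  rw [← hf.frameAt_eq hx y, inner_add_right, inner_smul_right, inner_smul_right]
  rcases hi with rfl | rfl
  · have hU : inner ℝ (frameAt F x y 2) (Ut F x y) = 0 := inner_rotA_eq_zero h1 h3
    have hW : inner ℝ (frameAt F x y 2) (Wt F x y) = 0 := inner_rotA_eq_zero h2 h4
    rw [hU, hW]; ring
  · have hU : inner ℝ (frameAt F x y 3) (Ut F x y) = 0 := inner_rotB_eq_zero h1 h3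
    have hW : inner ℝ (frameAt F x y 3) (Wt F x y) = 0 := inner_rotB_eq_zero h2 h4
    rw [hU, hW]; ring

theorem IsCurvatureSurface.centreX_sub_mem (y : ℝ) :
    centreX f F 1 y - centreX f F 1 0 ∈
      Submodule.span ℝ {frameAt F 1 0 2, frameAt F 1 0 3} := by
  have h1 : ∀ i : Fin 4, (i = 0 ∨ i = 1) →
      inner ℝ (frameAt F 1 0 i) (centreX f F 1 y - centreX f F 1 0) = (0 : ℝ) := fun i hi =>
    inner_eq_of_hasDerivAt isOpen_univ convex_univ
      (fun t _ => hf.hasDerivAt_centreX_snd one_pos t)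
      (fun t _ => hf.inner_frame_eq_zero_left one_pos t _ _ hi) (Set.mem_univ _) (Set.mem_univ _)
  rw [Submodule.mem_span_pair]
  have h2 := sum_inner_smul_of_orthonormal (hf.orthonormal_frameAt one_pos 0)
    (centreX f F 1 y - centreX f F 1 0)
  rw [h1 0 (by simp), h1 1 (by simp), zero_smul, zero_smul, zero_add, zero_add] at h2
  exact ⟨_, _, h2⟩

theorem IsCurvatureSurface.centreY_sub_mem {x : ℝ} (hx : 0 < x) :
    centreY f F x 0 - centreY f F 1 0 ∈
      Submodule.span ℝ {frameAt F 1 0 0, frameAt F 1 0 1} := by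
  have h1 : ∀ i : Fin 4, (i = 2 ∨ i = 3) →
      inner ℝ (frameAt F 1 0 i) (centreY f F x 0 - centreY f F 1 0) = (0 : ℝ) := fun i hi =>
    inner_eq_of_hasDerivAt (g := fun x => centreY f F x 0) isOpen_Ioi (convex_Ioi (0 : ℝ))
      (fun t ht => hf.hasDerivAt_centreY_fst ht 0)
      (fun t ht => hf.inner_frame_eq_zero_right ht 0 _ _ hi) hx (Set.mem_Ioi.mpr one_pos)
  rw [Submodule.mem_span_pair]
  have h2 := sum_inner_smul_of_orthonormal (hf.orthonormal_frameAt one_pos 0)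
    (centreY f F x 0 - centreY f F 1 0)
  rw [h1 2 (by simp), h1 3 (by simp), zero_smul, zero_smul, add_zero, add_zero] at h2
  exact ⟨_, _, h2⟩

end

end CurvSurf

end

theorem mainTheorem12 (f : ℝ × ℝ → CurvSurf.E4) (F : ℝ × ℝ → Fin 4 → CurvSurf.E4)
    (hf : CurvSurf.IsCurvatureSurface f F) :
    (∃! e : Fin 4 → CurvSurf.E4, CurvSurf.IsAsymptoticFrame F e) ∧
    (∃! A : ℝ → CurvSurf.E4, CurvSurf.IsCentreCurveX f F A) ∧
    (∃! At : Set.Ioi (0 : ℝ) → CurvSurf.E4, CurvSurf.IsCentreCurveY f F At) ∧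
    ∀ (e : Fin 4 → CurvSurf.E4) (A : ℝ → CurvSurf.E4) (At : Set.Ioi (0 : ℝ) → CurvSurf.E4),
      CurvSurf.IsAsymptoticFrame F e →
      CurvSurf.IsCentreCurveX f F A →
      CurvSurf.IsCentreCurveY f F At →
      (∃ p : CurvSurf.E4, ∀ y : ℝ,
        A y ∈ AffineSubspace.mk' p (Submodule.span ℝ {e 2, e 3})) ∧
      (∃ q : CurvSurf.E4, ∀ x : Set.Ioi (0 : ℝ),
        At x ∈ AffineSubspace.mk' q (Submodule.span ℝ {e 0, e 1})) := by
  refine ⟨⟨_, hf.isAsymptoticFrame, fun e he => he.unique hf.isAsymptoticFrame⟩,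
    ⟨_, hf.isCentreCurveX, fun A hA => hA.eq_centreX⟩,
    ⟨_, hf.isCentreCurveY, fun At hAt => hAt.eq_centreY⟩, ?_⟩
  intro e A At he hA hAt
  rw [he.unique hf.isAsymptoticFrame, hA.eq_centreX, hAt.eq_centreY]
  refine ⟨⟨CurvSurf.centreX f F 1 0, fun y => ?_⟩, ⟨CurvSurf.centreY f F 1 0, fun x => ?_⟩⟩
  · rw [AffineSubspace.mem_mk']
    exact hf.centreX_sub_mem y
  · rw [AffineSubspace.mem_mk']
    exact hf.centreY_sub_mem x.2
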